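/- A linear equation over variables $x_1,\dots,x_n$ is an equation $\sum_i c_i x_i = b$, and a quadratic equation is an equation $\sum_{i\le j} c_{ij}x_ix_j+\sum_i c_i x_i = b$, with integer coefficients written in unary (like monomials are collected, and constants are collected on the right-hand side). A formula of the linear (respectively quadratic) language is a finite collection $K$ of disjunctions of linear (respectively quadratic) equations over $x_1,\dots,x_n$. It is satisfiable if some assignment in $\{0,1\}^n$ makes at least one equation true in each of the disjunctions. Disjunctions are regarded as sets of equations. An R(lin) refutation of $K$ is a finite sequence of disjunctions of linear equations over $x_1,\dots,x_n$ that ends with the empty disjunction and in which each line is an element of $K$, or a Boolean axiom $x_i\in\{0,1\}$, i.e. $(x_i=0)\vee(x_i=1)$, or follows from earlier lines by one of the rules - Resolution: from $A\vee L_1$ and $B\vee L_2$ derive $A\vee B\vee (L_1-L_2)$; - Weakening: from $A$ derive $A\vee L$ for any linear equation $L$ over $x_1,\dots,x_n$; - Simplification: from $A\vee(0=k)$ with $k\neq 0$ derive $A$. R(quad) refutations are defined in the same way for quadratic equations, where the Boolean axioms are now $x_i\in\{0,1\}$, $x_i+x_j-x_ix_j\in\{0,1\}$ and $x_i-x_ix_j\in\{0,1\}$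 for all $i,j\in\{1,\dots,n\}$. A refutation system for one of these two languages is a polynomial-time decidable relation $P(\tau,\pi)$ between formulas $\tau$ and strings $\pi$ such that $\tau$ is unsatisfiable if and only if $P(\tau,\pi)$ holds for some $\pi$; such a $\pi$ is called a $P$-refutation of $\tau$. It is automatizable if there is an algorithm that, given any unsatisfiable $\tau$, outputs a $P$-refutation of $\tau$ in time polynomial in the length of $\tau$ plus the length of the shortest $P$-refutation of $\tau$. It polynomially simulates R(lin) (respectively R(quad)) if there is a polynomial-time computable function that maps every R(lin) (respectively R(quad)) refutation of a formula $\tau$ of the corresponding language, given together with $\tau$, to a $P$-refutation of $\tau$. Finally, R(lin) (respectively R(quad)) is weakly automatizable if there is an automatizable refutation system for its language that polynomially simulates it. **Theorem.** R(quad) is weakly automatizable if and only if R(lin) is weakly automatizable. -/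

import Mathlib

namespace ResEq

/-! ### Equations, disjunctions, formulas -/

/-- An equation `∑ₘ coeff m • m = rhs` with integer coefficients over a set `M` of formal monomials.
Like monomials are collected, and the constants are collected on the right-hand side. -/
@[ext]
structure Equation (M : Type) where
  coeff : M → ℤ
  rhs : ℤ

/-- The difference of two equations, side by side. -/
instance {M : Type} : Sub (Equation M) :=
  ⟨fun L₁ L₂ => ⟨L₁.coeff - L₂.coeff, L₁.rhs - L₂.rhs⟩⟩

/-- The equation `0 = k`. -/
def Equation.zeroEq (M : Type) (k : ℤ) : Equation M := ⟨0, k⟩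

/-- A disjunction of equations, written as a list. -/
abbrev Clause (M : Type) := List (Equation M)

/-- The disjunction as a set: order and repetitions of the disjuncts are immaterial. -/
def Clause.toSet {M : Type} (D : Clause M) : Set (Equation M) := {L | L ∈ D}

/-- A collection of disjunctions of equations in the variables `x₁, …, xₙ`; `M n` is the set of
monomials allowed over `n` variables. -/
structure Formula (M : ℕ → Type) where
  n : ℕ
  clauses : List (Clause (M n))

/-- The monomials of linear equations: the variables. -/
abbrev LinMonomial (n : ℕ) : Type := Fin n

/-- The monomials of quadratic equations: the variables `xᵢ` and the products `xᵢxⱼ = xⱼxᵢ`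
(`i = j` allowed). -/
abbrev QuadMonomial (n : ℕ) : Type := Fin n ⊕ Sym2 (Fin n)

/-- Collections of disjunctions of linear equations. -/
abbrev LinFormula := Formula LinMonomial

/-- Collections of disjunctions of quadratic equations. -/
abbrev QuadFormula := Formula QuadMonomial

/-! ### Satisfiability over 0/1 assignments -/

/-- The value of a variable under a 0/1 assignment. -/
def LinMonomial.val {n : ℕ} (a : Fin n → Bool) (i : LinMonomial n) : ℤ :=
  if a i then 1 else 0

/-- The value of a monomial of degree at most two under a 0/1 assignment. -/
def QuadMonomial.val {n : ℕ} (a : Fin n → Bool) : QuadMonomial n → ℤ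
  | Sum.inl i => LinMonomial.val a i
  | Sum.inr z => Sym2.lift
      ⟨fun i j => LinMonomial.val a i * LinMonomial.val a j, fun _ _ => mul_comm _ _⟩ z

/-- The equation holds when the monomials take the values `v`. -/
def Equation.Holds {M : Type} [Fintype M] (v : M → ℤ) (L : Equation M) : Prop :=
  ∑ m, L.coeff m * v m = L.rhs

/-- Some 0/1 assignment makes at least one equation true in each disjunction. -/
def LinFormula.Satisfiable (τ : LinFormula) : Prop :=
  ∃ a : Fin τ.n → Bool, ∀ D ∈ τ.clauses, ∃ L ∈ D, L.Holds (LinMonomial.val a)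

/-- Some 0/1 assignment makes at least one equation true in each disjunction. -/
def QuadFormula.Satisfiable (τ : QuadFormula) : Prop :=
  ∃ a : Fin τ.n → Bool, ∀ D ∈ τ.clauses, ∃ L ∈ D, L.Holds (QuadMonomial.val a)

/-! ### The inference rules -/

/-- `Step H P D`: the disjunction `D` is one of the initial disjunctions `H` or follows by one
inference rule from the disjunctions in `P`. -/
inductive Step {M : Type} (H P : Set (Set (Equation M))) : Set (Equation M) → Prop
  | initial {D : Set (Equation M)} : D ∈ H → Step H P D
  | resolution {A B : Set (Equation M)} {L₁ L₂ : Equation M} :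
      A ∪ {L₁} ∈ P → B ∪ {L₂} ∈ P → Step H P (A ∪ B ∪ {L₁ - L₂})
  | weakening {A : Set (Equation M)} (L : Equation M) : A ∈ P → Step H P (A ∪ {L})
  | simplification {A : Set (Equation M)} {k : ℤ} :
      k ≠ 0 → A ∪ {Equation.zeroEq M k} ∈ P → Step H P A

/-- The sequence of disjunctions `π` is a refutation of `K` with the additional axioms `Ax`: each
line is in `K`, is an axiom or follows from earlier lines, and the last line is the empty
disjunction. -/
def IsRefutation {M : Type} (Ax : Set (Set (Equation M))) (K : List (Clause M))
    (π : List (Clause M)) : Prop :=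
  (∀ (ρ : List (Clause M)) (D : Clause M) (σ : List (Clause M)), π = ρ ++ D :: σ →
    Step ({E | ∃ C ∈ K, E = Clause.toSet C} ∪ Ax) {E | ∃ C ∈ ρ, E = Clause.toSet C}
      (Clause.toSet D)) ∧
  π.getLast? = some []

/-- The disjunction `S ∈ {0, 1}`, that is `(S = 0) ∨ (S = 1)`, for a sum of monomials `S`. -/
def boolEq {M : Type} (S : M → ℤ) : Set (Equation M) := {⟨S, 0⟩, ⟨S, 1⟩}

/-- The Boolean axioms `xᵢ ∈ {0, 1}` of R(lin). -/
def linAxioms (n : ℕ) : Set (Set (Equation (LinMonomial n))) :=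
  {D | ∃ i : Fin n, D = boolEq (Pi.single i 1)}

/-- The monomial `xᵢ`, as a quadratic sum. -/
def quadVar {n : ℕ} (i : Fin n) : QuadMonomial n → ℤ := Pi.single (Sum.inl i) 1

/-- The monomial `xᵢxⱼ`, as a quadratic sum. -/
def quadProd {n : ℕ} (i j : Fin n) : QuadMonomial n → ℤ := Pi.single (Sum.inr s(i, j)) 1

/-- The Boolean axioms `xᵢ ∈ {0, 1}`, `xᵢ + xⱼ - xᵢxⱼ ∈ {0, 1}`, `xᵢ - xᵢxⱼ ∈ {0, 1}` of
R(quad). -/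
def quadAxioms (n : ℕ) : Set (Set (Equation (QuadMonomial n))) :=
  {D | ∃ i j : Fin n, D = boolEq (quadVar i) ∨ D = boolEq (quadVar i + quadVar j - quadProd i j) ∨
    D = boolEq (quadVar i - quadProd i j)}

/-! ### Encoding as strings over a finite alphabet, integers in unary -/

/-- The alphabet. -/
inductive Letter
  | plus
  | minus
  | comma
  | endEquation
  | endClause
  deriving DecidableEq

instance : Fintype Letter :=
  ⟨{.plus, .minus, .comma, .endEquation, .endClause}, fun x => by cases x <;> simp⟩

/-- An integer in unary: `|k|` copies of the sign of `k`. -/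
def encodeInt (k : ℤ) : List Letter :=
  List.replicate k.natAbs (if 0 ≤ k then Letter.plus else Letter.minus)

/-- An equation: its coefficients, in the order in which `ms` lists the monomials, each followed by
a comma, and then the right-hand side. -/
def encodeEquation {M : Type} (ms : List M) (L : Equation M) : List Letter :=
  ms.flatMap (fun m => encodeInt (L.coeff m) ++ [Letter.comma]) ++
    encodeInt L.rhs ++ [Letter.endEquation]

/-- A disjunction: its equations, one after the other. -/
def encodeClause {M : Type} (ms : List M) (D : Clause M) : List Letter :=
  D.flatMap (encodeEquation ms) ++ [Letter.endClause]

/-- A sequence of disjunctions. -/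
def encodeLines {M : Type} (ms : List M) (π : List (Clause M)) : List Letter :=
  π.flatMap (encodeClause ms)

/-- A formula: its number of variables in unary and then its disjunctions. -/
def Formula.encode {M : ℕ → Type} (ms : ∀ n, List (M n)) (τ : Formula M) : List Letter :=
  List.replicate τ.n Letter.plus ++ Letter.endClause :: encodeLines (ms τ.n) τ.clauses

/-- The variables in order. -/
def linMonomials (n : ℕ) : List (LinMonomial n) := List.finRange n

/-- The variables in order, and then the products `xᵢxⱼ`, `i ≤ j`, in lexicographic order. -/
def quadMonomials (n : ℕ) : List (QuadMonomial n) :=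
  (List.finRange n).map Sum.inl ++ (List.finRange n).sym2.map Sum.inr

/-- The encoding of collections of disjunctions of linear equations. -/
def LinFormula.encode (τ : LinFormula) : List Letter := Formula.encode linMonomials τ

/-- The encoding of collections of disjunctions of quadratic equations. -/
def QuadFormula.encode (τ : QuadFormula) : List Letter := Formula.encode quadMonomials τ

/-- R(lin): the string `s` is (the encoding of) an R(lin) refutation of `τ`. -/
def RLin (τ : LinFormula) (s : List Letter) : Prop :=
  ∃ π : List (Clause (LinMonomial τ.n)),
    IsRefutation (linAxioms τ.n) τ.clauses π ∧ encodeLines (linMonomials τ.n) π = s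

/-- R(quad): the string `s` is (the encoding of) an R(quad) refutation of `τ`. -/
def RQuad (τ : QuadFormula) (s : List Letter) : Prop :=
  ∃ π : List (Clause (QuadMonomial τ.n)),
    IsRefutation (quadAxioms τ.n) τ.clauses π ∧ encodeLines (quadMonomials τ.n) π = s

/-! ### Refutation systems, polynomial simulation, automatizability

`F` is a class of formulas, `enc` its encoding as strings, `Sat` its notion of satisfiability. A
relation `P : F → List Letter → Prop` says which strings are refutations of which formulas. The size
of a refutation is its length as a string. -/

variable {F : Type}

/-- The encoding of a pair that consists of a formula and a string: the letters of the formula are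
marked by `inl`, those of the string by `inr`. -/
def encodePair (enc : F → List Letter) (x : F × List Letter) : List (Letter ⊕ Letter) :=
  (enc x.1).map Sum.inl ++ x.2.map Sum.inr

/-- `f` is computable by a (multi-tape) Turing machine in polynomial time. -/
def PolyTime {α β Γ Δ : Type} (ea : α → List Γ) (eb : β → List Δ) (f : α → β) : Prop :=
  Nonempty (Turing.TM2ComputableInPolyTime ea eb f)

/-- A refutation system: a polynomial-time relation under which exactly the unsatisfiable formulas
have refutations. -/
structure IsRefutationSystem (enc : F → List Letter) (Sat : F → Prop)
    (P : F → List Letter → Prop) : Prop where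
  polyTime : ∃ v : F × List Letter → Bool,
    PolyTime (encodePair enc) Computability.encodeBool v ∧ ∀ τ π, v (τ, π) = true ↔ P τ π
  unsat_iff : ∀ τ, ¬ Sat τ ↔ ∃ π, P τ π

/-- `P` polynomially simulates `Q`: a polynomial-time function turns each `Q`-refutation of a
formula into a `P`-refutation of the same formula. -/
def PolySimulates (enc : F → List Letter) (P Q : F → List Letter → Prop) : Prop :=
  ∃ f : F × List Letter → List Letter, PolyTime (encodePair enc) id f ∧
    ∀ τ π, Q τ π → P τ (f (τ, π))

/-- `P` is automatizable: some Turing machine, given an unsatisfiable formula `τ`, outputs a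
`P`-refutation of `τ` in time polynomial in the length of `τ` and of the shortest `P`-refutation of
`τ` (equivalently, in the length of `τ` and of any `P`-refutation `π'` of `τ`). -/
def Automatizable (enc : F → List Letter) (Sat : F → Prop) (P : F → List Letter → Prop) : Prop :=
  ∃ (T : Turing.TM2ComputableAux Letter Letter) (p : Polynomial ℕ), ∀ τ, ¬ Sat τ →
    ∃ π, P τ π ∧ ∀ π', P τ π' →
      Nonempty (Turing.TM2OutputsInTime T.tm ((enc τ).map T.inputAlphabet.invFun)
        (some (π.map T.outputAlphabet.invFun)) (p.eval ((enc τ).length + π'.length)))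

/-- `Q` is weakly automatizable: some automatizable refutation system (for the same class of
formulas) polynomially simulates `Q`. -/
def WeaklyAutomatizable (enc : F → List Letter) (Sat : F → Prop)
    (Q : F → List Letter → Prop) : Prop :=
  ∃ P : F → List Letter → Prop,
    IsRefutationSystem enc Sat P ∧ Automatizable enc Sat P ∧ PolySimulates enc P Q

end ResEq

namespace ResEq

open Function Turing

/-! ### Structured programs on stacks -/

/-! Both implications come from a polynomial-time reduction between the two languages that preserves
satisfiability and carries refutations along. If `red` is such a reduction and `P` is an
automatizable system for the target language, then `P (red τ) π` is a refutation system for the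
source language. A refutation of `τ` is literally a `P`-refutation of `red τ`, so the shortest
lengths agree and automatizability is inherited. Composing the translation of refutations with the
simulation by `P` gives the simulation in the source language. This is
`WeaklyAutomatizable.of_reduction`.

From linear to quadratic, the reduction is the inclusion: a linear equation is a quadratic one whose
product coefficients vanish, and an R(lin) refutation is then an R(quad) refutation (`RLin.rQuad`).
On strings, the inclusion inserts the commas of the vanishing coefficients.

From quadratic to linear, every monomial becomes a variable, and the Boolean axioms about products
become clauses of the formula. For `x, y, z ∈ {0, 1}`, the conditions `x + y - z, x - z, y - z ∈ {0,
1}` say exactly that `z = xy`, so satisfiability is preserved (`toLinFormula_satisfiable`). The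
rules act coefficient by coefficient, so an R(quad) refutation is already an R(lin) refutation of
the new formula, given by the same string (`RQuad.rLin`).

The remaining work is to realize these string transformations by Turing machines. They are written
as small stack programs with explicit running times, and only one construction on machines is
needed: putting such a program in front of a given machine (`Prog.exists_precomp`). -/

/-- Structured programs on stacks indexed by `J`, all over the alphabet `A`. The program
`loop j c b` pops letters `a` from the stack `j`, running `b a` after each of them, until the stack
is empty or the popped letter does not satisfy `c`. -/
inductive Prog (J A : Type) : Type
  | push (j : J) (a : A)
  | pop (j : J)
  | seq (p q : Prog J A)
  | loop (j : J) (c : A → Bool) (b : A → Prog J A)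

namespace Prog

variable {J A : Type}

section Semantics

variable [DecidableEq J]

/-- `Runs p S S' t`: the program `p` turns the stacks `S` into `S'` in exactly `t` steps. -/
inductive Runs : Prog J A → (J → List A) → (J → List A) → ℕ → Prop
  | push (j a S) : Runs (.push j a) S (update S j (a :: S j)) 1
  | pop (j S) : Runs (.pop j) S (update S j (S j).tail) 1
  | seq {p q S S' S'' t t'} : Runs p S S' t → Runs q S' S'' t' → Runs (.seq p q) S S'' (t + t')
  | loop_nil {j c b S} : S j = [] → Runs (.loop j c b) S S 1
  | loop_exit {j c b S a l} : S j = a :: l → c a = false →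
      Runs (.loop j c b) S (update S j l) 1
  | loop_step {j c b S a l S' S'' t t'} : S j = a :: l → c a = true →
      Runs (b a) (update S j l) S' t → Runs (.loop j c b) S' S'' t' →
      Runs (.loop j c b) S S'' (1 + t + t')

/-- A step pushes at most one letter, so running time bounds the growth of every stack. Polynomial
bounds on output lengths follow from bounds on time. -/
theorem Runs.length_le {p : Prog J A} {S S' : J → List A} {t : ℕ} (h : Runs p S S' t) (k : J) :
    (S' k).length ≤ (S k).length + t := by
  induction h with
  | push j a S =>
    by_cases hk : k = j
    · subst hk; simp
    · simp [update_of_ne hk]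
  | pop j S =>
    by_cases hk : k = j
    · subst hk; simp; omega
    · simp [update_of_ne hk]
  | seq _ _ ih₁ ih₂ => omega
  | loop_nil _ => omega
  | @loop_exit j c b S a l h _ =>
    by_cases hk : k = j
    · subst hk; simp [h]; omega
    · simp [update_of_ne hk]
  | @loop_step j c b S a l S' S'' t t' h _ _ _ ih₁ ih₂ =>
    have : (update S j l k).length ≤ (S k).length := by
      by_cases hk : k = j
      · subst hk; simp [h]
      · simp [update_of_ne hk]
    omega

/-- `RunsIn p S S' t`: the program `p` turns the stacks `S` into `S'` in at most `t` steps. -/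
def RunsIn (p : Prog J A) (S S' : J → List A) (t : ℕ) : Prop := ∃ t' ≤ t, Runs p S S' t'

end Semantics

/-! ### Compilation to Turing machines -/

/-- The control positions of a program. -/
def Pos : Prog J A → Type
  | push _ _ => Unit
  | pop _ => Unit
  | seq p q => Pos p ⊕ Pos q
  | loop _ _ b => Unit ⊕ Σ a, Pos (b a)

instance finite_pos [Finite A] : ∀ p : Prog J A, Finite p.Pos
  | push _ _ => inferInstanceAs (Finite Unit)
  | pop _ => inferInstanceAs (Finite Unit)
  | seq p q =>
    have := finite_pos p
    have := finite_pos q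
    inferInstanceAs (Finite (Pos p ⊕ Pos q))
  | loop _ _ b =>
    have := fun a => finite_pos (b a)
    inferInstanceAs (Finite (Unit ⊕ Σ a, Pos (b a)))

/-- The position at which a program starts. -/
def entry : (p : Prog J A) → Pos p
  | push _ _ => ()
  | pop _ => ()
  | seq p _ => Sum.inl (entry p)
  | loop _ _ _ => Sum.inl ()

variable {K Λ σ : Type} (Γ : K → Type)

/-- The alphabets of the stacks of a program together with those of a machine. -/
@[reducible]
def Alphabets (J A : Type) {K : Type} (Γ : K → Type) : J ⊕ K → Type
  | .inl _ => A
  | .inr k => Γ k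

variable {Γ}

/-- The code of a program, where `e` gives the labels of its positions and `x` is the label that
follows it. -/
def code : (p : Prog J A) → (e : Pos p → Λ) → (x : Λ) → Pos p →
    TM2.Stmt (Alphabets J A Γ) Λ (Option A × σ)
  | push j a, _, x, _ => .push (Sum.inl j) (fun _ => a) (.goto fun _ => x)
  | pop j, _, x, _ => .pop (Sum.inl j) (fun v _ => v) (.goto fun _ => x)
  | seq p q, e, _, .inl i => code p (fun i => e (.inl i)) (e (.inr (entry q))) i
  | seq _ q, e, x, .inr i => code q (fun i => e (.inr i)) x i
  | loop j c b, e, x, .inl _ => .pop (Sum.inl j) (fun v o => (o, v.2)) (.goto fun v =>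
      match v.1 with
      | none => x
      | some a => if c a then e (.inr ⟨a, entry (b a)⟩) else x)
  | loop _ _ b, e, _, .inr ⟨a, i⟩ => code (b a) (fun i => e (.inr ⟨a, i⟩)) (e (.inl ())) i

/-- The stacks of a program and those of a machine, together. -/
def joinStacks (S : J → List A) (R : ∀ k, List (Γ k)) : ∀ k, List (Alphabets J A Γ k)
  | .inl j => S j
  | .inr k => R k

variable [DecidableEq J] [DecidableEq K]

theorem update_joinStacks_inl (S : J → List A) (R : ∀ k, List (Γ k)) (j : J) (l : List A) :
    update (joinStacks S R) (.inl j) l = joinStacks (update S j l) R := by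
  funext k
  rcases k with k | k
  · by_cases h : k = j
    · subst h; simp [joinStacks]
    · rw [update_of_ne (by simpa using h)]; simp [joinStacks, update_of_ne h]
  · rw [update_of_ne (by simp)]; rfl

theorem update_joinStacks_inr (S : J → List A) (R : ∀ k, List (Γ k)) (k : K) (l : List (Γ k)) :
    update (joinStacks S R) (.inr k) l = joinStacks S (update R k l) := by
  funext k'
  rcases k' with k' | k'
  · rw [update_of_ne (by simp)]; rfl
  · by_cases h : k' = k
    · subst h; simp [joinStacks]
    · rw [update_of_ne (by simpa using h)]; simp [joinStacks, update_of_ne h]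

/-- `StepsTo M n c c'`: the machine `M` goes from `c` to `c'` in `n` steps. -/
def StepsTo {K Λ σ : Type} [DecidableEq K] {Γ : K → Type} (M : Λ → TM2.Stmt Γ Λ σ) (n : ℕ)
    (c c' : TM2.Cfg Γ Λ σ) : Prop :=
  (flip bind (TM2.step M))^[n] (some c) = some c'

theorem StepsTo.trans {K Λ σ : Type} [DecidableEq K] {Γ : K → Type} {M : Λ → TM2.Stmt Γ Λ σ}
    {n n' : ℕ} {c c' c'' : TM2.Cfg Γ Λ σ} (h : StepsTo M n c c') (h' : StepsTo M n' c' c'') :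
    StepsTo M (n + n') c c'' := by
  unfold StepsTo at *
  rw [Nat.add_comm, iterate_add_apply, h, h']

theorem StepsTo.single {K Λ σ : Type} [DecidableEq K] {Γ : K → Type} {M : Λ → TM2.Stmt Γ Λ σ}
    {l : Λ} {v : σ} {S : ∀ k, List (Γ k)} {c : TM2.Cfg Γ Λ σ}
    (h : TM2.stepAux (M l) v S = c) : StepsTo M 1 ⟨some l, v, S⟩ c := by
  simp [StepsTo, flip, h]

/-- Induction on the run, with one machine step for each program step. The label map `e` and the
exit `x` are arbitrary so that the induction applies to subprograms inside a larger code. The final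
register is existential because a loop leaves there whatever it popped last. -/
theorem Runs.stepsTo {M : Λ → TM2.Stmt (Alphabets J A Γ) Λ (Option A × σ)} {p : Prog J A}
    {S S' : J → List A} {t : ℕ} (h : Runs p S S' t) :
    ∀ (e : Pos p → Λ) (x : Λ), (∀ i, M (e i) = code p e x i) → ∀ (r : Option A) (v : σ) R,
      ∃ r', StepsTo M t ⟨some (e (entry p)), (r, v), joinStacks S R⟩
        ⟨some x, (r', v), joinStacks S' R⟩ := by
  induction h with
  | push j a S =>
    intro e x hM r v R
    refine ⟨r, .single ?_⟩
    rw [hM]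
    simp [code, ← update_joinStacks_inl, joinStacks]
  | pop j S =>
    intro e x hM r v R
    refine ⟨r, .single ?_⟩
    rw [hM]
    simp [code, ← update_joinStacks_inl, joinStacks]
  | @seq p q _ _ _ _ _ _ _ ih₁ ih₂ =>
    intro e x hM r v R
    obtain ⟨r₁, h₁⟩ := ih₁ (fun i => e (.inl i)) (e (.inr (entry q))) (fun i => hM (.inl i)) r v R
    obtain ⟨r₂, h₂⟩ := ih₂ (fun i => e (.inr i)) x (fun i => hM (.inr i)) r₁ v R
    exact ⟨r₂, h₁.trans h₂⟩
  | @loop_nil j c b S h =>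
    intro e x hM r v R
    refine ⟨none, .single ?_⟩
    -- Popping an empty stack writes `[]` back, which changes nothing.
    have hS : update S j [] = S := by rw [← h, update_eq_self]
    rw [hM]
    simp [code, entry, update_joinStacks_inl, joinStacks, h, hS]
  | @loop_exit j c b S a l h hc =>
    intro e x hM r v R
    refine ⟨some a, .single ?_⟩
    rw [hM]
    simp [code, entry, update_joinStacks_inl, joinStacks, h, hc]
  | @loop_step j c b S a l S' S'' t t' h hc _ _ ih₁ ih₂ =>
    intro e x hM r v R
    have h₀ : StepsTo M 1 ⟨some (e (entry (loop j c b))), (r, v), joinStacks S R⟩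
        ⟨some (e (.inr ⟨a, entry (b a)⟩)), (some a, v), joinStacks (update S j l) R⟩ := by
      refine .single ?_
      rw [hM]
      simp [code, entry, update_joinStacks_inl, joinStacks, h, hc]
    obtain ⟨r₁, h₁⟩ := ih₁ (fun i => e (.inr ⟨a, i⟩)) (e (.inl ()))
      (fun i => hM (.inr ⟨a, i⟩)) (some a) v R
    obtain ⟨r₂, h₂⟩ := ih₂ e x hM r₁ v R
    exact ⟨r₂, (h₀.trans h₁).trans h₂⟩

/-! ### A program followed by a machine -/

/-- A statement of a machine, as a statement of the machine with additional labels and stacks. -/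
def liftStmt {Λ' : Type} (e : Λ' → Λ) :
    TM2.Stmt Γ Λ' σ → TM2.Stmt (Alphabets J A Γ) Λ (Option A × σ)
  | .push k f q => .push (Sum.inr k) (fun v => f v.2) (liftStmt e q)
  | .peek k f q => .peek (Sum.inr k) (fun v o => (v.1, f v.2 o)) (liftStmt e q)
  | .pop k f q => .pop (Sum.inr k) (fun v o => (v.1, f v.2 o)) (liftStmt e q)
  | .load f q => .load (fun v => (v.1, f v.2)) (liftStmt e q)
  | .branch f q q' => .branch (fun v => f v.2) (liftStmt e q) (liftStmt e q')
  | .goto f => .goto fun v => e (f v.2)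
  | .halt => .halt

/-- A configuration of a machine, as one of the machine with additional labels and stacks. -/
def liftCfg {Λ' : Type} (e : Λ' → Λ) (S : J → List A) (c : TM2.Cfg Γ Λ' σ) :
    TM2.Cfg (Alphabets J A Γ) Λ (Option A × σ) :=
  ⟨c.l.map e, (none, c.var), joinStacks S c.stk⟩

/-- Lifted statements never write to the program's register, so its value `none`, fixed in
`liftCfg`, persists. -/
theorem stepAux_liftStmt {Λ' : Type} (e : Λ' → Λ) (S : J → List A) (q : TM2.Stmt Γ Λ' σ) :
    ∀ (v : σ) (R : ∀ k, List (Γ k)),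
      TM2.stepAux (liftStmt e q) (none, v) (joinStacks S R) = liftCfg e S (TM2.stepAux q v R) := by
  induction q with
  | push k f q ih => intro v R; simp [liftStmt, update_joinStacks_inr, joinStacks, ih]
  | peek k f q ih => intro v R; simp [liftStmt, joinStacks, ih]
  | pop k f q ih => intro v R; simp [liftStmt, update_joinStacks_inr, joinStacks, ih]
  | load f q ih => intro v R; simp [liftStmt, ih]
  | branch f q q' ih ih' =>
    intro v R
    cases h : f v <;> simp [liftStmt, ih, ih', h]
  | goto f => intro v R; simp [liftStmt, liftCfg]
  | halt => intro v R; simp [liftStmt, liftCfg]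

theorem stepsTo_liftCfg {Λ' : Type} (e : Λ' → Λ) (S : J → List A) {m : Λ' → TM2.Stmt Γ Λ' σ}
    {M : Λ → TM2.Stmt (Alphabets J A Γ) Λ (Option A × σ)} (hM : ∀ l, M (e l) = liftStmt e (m l))
    {n : ℕ} : ∀ {c c' : TM2.Cfg Γ Λ' σ}, StepsTo m n c c' →
      StepsTo M n (liftCfg e S c) (liftCfg e S c') := by
  induction n with
  | zero =>
    intro c c' h
    have : c = c' := by simpa [StepsTo] using h
    simp [StepsTo, this]
  | succ n ih =>
    intro c c' h
    -- A halted configuration has no successor, so a run of positive length must start at an actual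
    -- label.
    have hnone : ∀ n, (flip bind (TM2.step m))^[n] none = none := by
      intro n
      induction n with
      | zero => rfl
      | succ n ih => rw [iterate_succ_apply]; exact ih
    obtain ⟨_ | l, v, R⟩ := c
    · simp only [StepsTo, iterate_succ_apply] at h
      exact absurd ((hnone n).symm.trans h) (by simp)
    · have h' : StepsTo m n (TM2.stepAux (m l) v R) c' := h
      have hs : StepsTo M 1 (liftCfg e S ⟨some l, v, R⟩)
          (liftCfg e S (TM2.stepAux (m l) v R)) := by
        refine .single ?_
        rw [hM, stepAux_liftStmt]
      rw [Nat.add_comm]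
      exact hs.trans (ih h')

/-- The labels of a program, of the transfer of its output, and of the machine that follows. -/
abbrev CompLabel (p : Prog J A) (Λ : Type) : Type := p.Pos ⊕ Option A ⊕ Λ

/-- The stack `j` contains `l`, and the other stacks are empty. -/
def single (j : J) (l : List A) : J → List A := update (fun _ => []) j l

/-- The code of the program `p`, followed by the transfer of the stack `out` to the stack `k` of
the machine with the code `m`, followed by that machine, started at `l₀`. -/
def compCode (p : Prog J A) (out : J) (k : K) (g : A → Γ k) (l₀ : Λ) (m : Λ → TM2.Stmt Γ Λ σ) :
    CompLabel p Λ → TM2.Stmt (Alphabets J A Γ) (CompLabel p Λ) (Option A × σ)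
  | .inl i => code p Sum.inl (.inr (.inl none)) i
  | .inr (.inl none) => .pop (Sum.inl out) (fun v o => (o, v.2)) (.goto fun v =>
      match v.1 with
      | none => .inr (.inr l₀)
      | some a => .inr (.inl (some a)))
  | .inr (.inl (some a)) => .push (Sum.inr k) (fun _ => g a) (.goto fun _ => .inr (.inl none))
  | .inr (.inr l) => liftStmt (fun l => .inr (.inr l)) (m l)

/-- Two steps per letter, and a last pop of the empty stack that resets the register to `none`, as
`liftCfg` requires. The transfer reverses the string, which is why programs are asked to leave their
output reversed. -/
theorem stepsTo_transfer (p : Prog J A) (out : J) (k : K) (g : A → Γ k) (l₀ : Λ)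
    (m : Λ → TM2.Stmt Γ Λ σ) (v : σ) (y : List A) : ∀ (r : Option A) (R : ∀ k, List (Γ k)),
    StepsTo (compCode p out k g l₀ m) (2 * y.length + 1)
      ⟨some (.inr (.inl none)), (r, v), joinStacks (single out y) R⟩
      ⟨some (.inr (.inr l₀)), (none, v),
        joinStacks (fun _ => []) (update R k (y.reverse.map g ++ R k))⟩ := by
  induction y with
  | nil =>
    intro r R
    refine .single ?_
    simp [compCode, joinStacks, single, update_joinStacks_inl]
  | cons a y ih =>
    intro r R
    have h₁ : StepsTo (compCode p out k g l₀ m) 1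
        ⟨some (.inr (.inl none)), (r, v), joinStacks (single out (a :: y)) R⟩
        ⟨some (.inr (.inl (some a))), (some a, v), joinStacks (single out y) R⟩ := by
      refine .single ?_
      simp [compCode, joinStacks, single, update_joinStacks_inl]
    have h₂ : StepsTo (compCode p out k g l₀ m) 1
        ⟨some (.inr (.inl (some a))), (some a, v), joinStacks (single out y) R⟩
        ⟨some (.inr (.inl none)), (some a, v),
          joinStacks (single out y) (update R k (g a :: R k))⟩ := by
      refine .single ?_
      simp [compCode, joinStacks, update_joinStacks_inr]
    have h₃ := (h₁.trans h₂).trans (ih (some a) (update R k (g a :: R k)))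
    have e : 1 + 1 + (2 * y.length + 1) = 2 * (a :: y).length + 1 := by simp; ring
    rw [e] at h₃
    simpa using h₃

/-- The program `p`, followed by the transfer of the stack `out` to the input stack of the machine
`tm`, followed by `tm`. -/
noncomputable def compMachine [Fintype J] [Fintype A] (p : Prog J A) (inp out : J) (tm : FinTM2)
    (g : A → tm.Γ tm.k₀) : FinTM2 :=
  letI := tm.kFin
  letI := tm.ΛFin
  letI := tm.σFin
  letI := Fintype.ofFinite p.Pos
  letI : Fintype (Alphabets J A tm.Γ (Sum.inl inp)) := inferInstanceAs (Fintype A)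
  { K := J ⊕ tm.K
    k₀ := Sum.inl inp
    k₁ := Sum.inr tm.k₁
    Γ := Alphabets J A tm.Γ
    Λ := CompLabel p tm.Λ
    main := Sum.inl p.entry
    σ := Option A × tm.σ
    initialState := (none, tm.initialState)
    m := compCode p out tm.k₀ g tm.main tm.m }

theorem initList_stk_self (tm : FinTM2) (x : List (tm.Γ tm.k₀)) :
    (initList tm x).stk tm.k₀ = x := by
  simp only [initList, dite_true]
  rfl

theorem initList_stk_of_ne (tm : FinTM2) (x : List (tm.Γ tm.k₀)) {k : tm.K} (h : k ≠ tm.k₀) :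
    (initList tm x).stk k = [] := dif_neg h

theorem haltList_stk_self (tm : FinTM2) (x : List (tm.Γ tm.k₁)) :
    (haltList tm x).stk tm.k₁ = x := by
  simp only [haltList, dite_true]
  rfl

theorem haltList_stk_of_ne (tm : FinTM2) (x : List (tm.Γ tm.k₁)) {k : tm.K} (h : k ≠ tm.k₁) :
    (haltList tm x).stk k = [] := dif_neg h

theorem initList_eq (tm : FinTM2) (x : List (tm.Γ tm.k₀)) :
    initList tm x = ⟨some tm.main, tm.initialState, update (fun _ => []) tm.k₀ x⟩ := by
  have h : (initList tm x).stk = update (fun _ => []) tm.k₀ x := by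
    funext k
    by_cases h : k = tm.k₀
    · subst h; rw [initList_stk_self, update_self]
    · rw [initList_stk_of_ne tm x h, update_of_ne h]
  rw [← h]
  rfl

theorem initList_compMachine [Fintype J] [Fintype A] (p : Prog J A) (inp out : J) (tm : FinTM2)
    (g : A → tm.Γ tm.k₀) (x : List A) :
    initList (compMachine p inp out tm g) x =
      ⟨some (.inl p.entry), (none, tm.initialState), joinStacks (single inp x) fun _ => []⟩ := by
  have h : (initList (compMachine p inp out tm g) x).stk =
      joinStacks (Γ := tm.Γ) (single inp x) fun _ => [] := by
    funext k
    rcases k with k | k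
    · by_cases h : k = inp
      · subst h
        exact (initList_stk_self (compMachine p k out tm g) x).trans
          (update_self (β := fun _ => List A) k x fun _ => []).symm
      · exact (initList_stk_of_ne (compMachine p inp out tm g) x
          (show (Sum.inl k : J ⊕ tm.K) ≠ Sum.inl inp by simpa using h)).trans
          (update_of_ne (f := fun _ => []) h x).symm
    · exact initList_stk_of_ne (compMachine p inp out tm g) x
        (show (Sum.inr k : J ⊕ tm.K) ≠ Sum.inl inp by simp)
  rw [← h]
  rfl

theorem haltList_compMachine [Fintype J] [Fintype A] (p : Prog J A) (inp out : J) (tm : FinTM2)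
    (g : A → tm.Γ tm.k₀) (y : List (tm.Γ tm.k₁)) :
    haltList (compMachine p inp out tm g) y =
      liftCfg (fun l => (.inr (.inr l) : CompLabel p tm.Λ)) (fun _ => []) (haltList tm y) := by
  have h : (haltList (compMachine p inp out tm g) y).stk =
      joinStacks (Γ := tm.Γ) (fun _ => []) (haltList tm y).stk := by
    funext k
    rcases k with k | k
    · exact haltList_stk_of_ne (compMachine p inp out tm g) y
        (show (Sum.inl k : J ⊕ tm.K) ≠ Sum.inr tm.k₁ by simp)
    · by_cases h : k = tm.k₁
      · subst h
        exact (haltList_stk_self (compMachine p inp out tm g) y).trans (haltList_stk_self tm y).symm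
      · exact (haltList_stk_of_ne (compMachine p inp out tm g) y
          (show (Sum.inr k : J ⊕ tm.K) ≠ Sum.inr tm.k₁ by simpa using h)).trans
          (haltList_stk_of_ne tm y h).symm
  unfold liftCfg
  rw [← h]
  rfl

/-- A machine can be preceded by a program. -/
theorem exists_precomp {J A B : Type} [DecidableEq J] [Fintype J] [Fintype A] (p : Prog J A)
    (inp out : J) (T : TM2ComputableAux A B) : ∃ T' : TM2ComputableAux A B,
      ∀ (x y : List A) (z : List B) (t t' : ℕ), RunsIn p (single inp x) (single out y) t →
        Nonempty (TM2OutputsInTime T.tm (y.reverse.map T.inputAlphabet.invFun)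
          (some (z.map T.outputAlphabet.invFun)) t') →
        Nonempty (TM2OutputsInTime T'.tm (x.map T'.inputAlphabet.invFun)
          (some (z.map T'.outputAlphabet.invFun)) (t + (2 * y.length + 1) + t')) := by
  refine ⟨⟨compMachine p inp out T.tm T.inputAlphabet.invFun, Equiv.refl A, T.outputAlphabet⟩, ?_⟩
  rintro x y z t t' ⟨s, hs, hp⟩ ⟨⟨⟨s', hsteps⟩, hs'⟩⟩
  set c := compCode p out T.tm.k₀ T.inputAlphabet.invFun T.tm.main T.tm.m with hc
  obtain ⟨r, h₁⟩ := hp.stepsTo (M := c) Sum.inl (.inr (.inl none)) (fun _ => rfl) none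
    T.tm.initialState fun _ => []
  have h₂ := stepsTo_transfer p out T.tm.k₀ T.inputAlphabet.invFun T.tm.main T.tm.m
    T.tm.initialState y r fun _ => []
  have h₃ : StepsTo T.tm.m s' (initList T.tm (y.reverse.map T.inputAlphabet.invFun))
    (haltList T.tm (z.map T.outputAlphabet.invFun)) := hsteps
  have h₄ := stepsTo_liftCfg (fun l => (.inr (.inr l) : CompLabel p T.tm.Λ)) (fun _ : J => [])
    (M := c) (fun _ => rfl) h₃
  rw [initList_eq, ← haltList_compMachine p inp out T.tm T.inputAlphabet.invFun] at h₄
  rw [List.append_nil] at h₂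
  have h := (h₁.trans h₂).trans h₄
  -- The list is generalized because the input of the composite is the image of `x` under the
  -- identity of the alphabet, which equals `x` only by `List.map_id`.
  have h' (w : List A) (hw : w = x) : (flip bind (compMachine p inp out T.tm T.inputAlphabet.invFun).step)^[
      s + (2 * y.length + 1) + s']
      (some (initList (compMachine p inp out T.tm T.inputAlphabet.invFun) w)) =
      some (haltList (compMachine p inp out T.tm T.inputAlphabet.invFun)
        (z.map T.outputAlphabet.invFun)) := by
    rw [hw, initList_compMachine]
    exact h
  refine ⟨⟨⟨s + (2 * y.length + 1) + s', ?_⟩, ?_⟩⟩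
  · exact h' _ (List.map_id x)
  · dsimp only at hs' ⊢
    omega

end Prog

/-! ### Reductions computed by programs -/

/-- Some program turns the strings `ea x` into the strings `eb x` in polynomial time. -/
def ProgTransforms {α A : Type} (ea eb : α → List A) : Prop :=
  ∃ (J : Type) (_ : DecidableEq J) (_ : Fintype J) (p : Prog J A) (inp out : J)
    (q : Polynomial ℕ), ∀ x, p.RunsIn (Prog.single inp (ea x)) (Prog.single out (eb x).reverse)
      (q.eval (ea x).length)

theorem eval_le_eval (p : Polynomial ℕ) {m n : ℕ} (h : m ≤ n) : p.eval m ≤ p.eval n := by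
  rw [Polynomial.eval_eq_sum, Polynomial.eval_eq_sum]
  exact Finset.sum_le_sum fun i _ => Nat.mul_le_mul_left _ (Nat.pow_le_pow_left h i)

theorem ProgTransforms.exists_precomp {α A B : Type} [Fintype A] {ea eb : α → List A}
    (h : ProgTransforms ea eb) (T : TM2ComputableAux A B) :
    ∃ (T' : TM2ComputableAux A B) (q : Polynomial ℕ),
      (∀ x, (eb x).length ≤ q.eval (ea x).length) ∧ ∀ (x : α) (z : List B) (t : ℕ),
        Nonempty (TM2OutputsInTime T.tm ((eb x).map T.inputAlphabet.invFun)
          (some (z.map T.outputAlphabet.invFun)) t) →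
        Nonempty (TM2OutputsInTime T'.tm ((ea x).map T'.inputAlphabet.invFun)
          (some (z.map T'.outputAlphabet.invFun)) (q.eval (ea x).length + t)) := by
  obtain ⟨J, _, _, p, inp, out, q, hq⟩ := h
  obtain ⟨T', hT'⟩ := Prog.exists_precomp p inp out T
  have hl : ∀ x, (eb x).length ≤ (ea x).length + q.eval (ea x).length := by
    intro x
    obtain ⟨t, ht, hr⟩ := hq x
    have h₁ := hr.length_le out
    have h₂ : (Prog.single inp (ea x) out).length ≤ (ea x).length := by
      by_cases h : out = inp
      · subst h; simp [Prog.single]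
      · simp [Prog.single, Function.update_of_ne h]
    simp only [Prog.single, Function.update_self, List.length_reverse] at h₁ h₂
    omega
  -- The time `q` of the program plus the transfer of an output of length at most `X + q`. The same
  -- polynomial bounds the length of the output.
  refine ⟨T', q + (2 * (Polynomial.X + q) + 1), fun x => ?_, fun x z t hT => ?_⟩
  · have := hl x
    simp only [Polynomial.eval_add, Polynomial.eval_mul, Polynomial.eval_X, Polynomial.eval_one,
      Polynomial.eval_ofNat]
    omega
  · obtain ⟨H⟩ := hT' (ea x) (eb x).reverse z _ t (hq x) (by rwa [List.reverse_reverse])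
    refine ⟨⟨H.toEvalsTo, H.steps_le_m.trans ?_⟩⟩
    have := hl x
    simp only [Polynomial.eval_add, Polynomial.eval_mul, Polynomial.eval_X, Polynomial.eval_one,
      Polynomial.eval_ofNat, List.length_reverse]
    omega

/-- A polynomial-time function remains one after composition with a program. -/
theorem PolyTime.comp_prog {α β γ A B : Type} [Fintype A] {ea : α → List A} {eb : β → List A}
    {ec : γ → List B} {g : β → γ} {f : α → β} (hg : PolyTime eb ec g)
    (hf : ProgTransforms ea (fun x => eb (f x))) : PolyTime ea ec (fun x => g (f x)) := by
  obtain ⟨G⟩ := hg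
  obtain ⟨T', q, hq, hT'⟩ := hf.exists_precomp G.toTM2ComputableAux
  refine ⟨⟨T', q + G.time.comp q, fun x => ?_⟩⟩
  have H := (hT' x (ec (g (f x))) _ ⟨G.outputsFun (f x)⟩).some
  refine ⟨H.toEvalsTo, H.steps_le_m.trans ?_⟩
  simp only [Polynomial.eval_add, Polynomial.eval_comp]
  exact Nat.add_le_add_left (eval_le_eval _ (hq x)) _

/-- Weak automatizability can be pulled back along a reduction `red` that is computed by programs,
given a translation `tr` of refutations. -/
theorem WeaklyAutomatizable.of_reduction {F G : Type} {encF : F → List Letter}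
    {encG : G → List Letter} {SatF : F → Prop} {SatG : G → Prop} {QF : F → List Letter → Prop}
    {QG : G → List Letter → Prop} (red : F → G) (tr : F × List Letter → List Letter)
    (hsat : ∀ τ, SatG (red τ) ↔ SatF τ) (htr : ∀ τ π, QF τ π → QG (red τ) (tr (τ, π)))
    (h₁ : ProgTransforms encF (fun τ => encG (red τ)))
    (h₂ : ProgTransforms (encodePair encF) (fun x => encodePair encG (red x.1, x.2)))
    (h₃ : ProgTransforms (encodePair encF) (fun x => encodePair encG (red x.1, tr x)))
    (h : WeaklyAutomatizable encG SatG QG) : WeaklyAutomatizable encF SatF QF := by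
  obtain ⟨P, ⟨⟨v, hv, hvP⟩, hunsat⟩, ⟨T, p, hT⟩, f, hf, hfP⟩ := h
  -- The new system refutes `τ` by the `P`-refutations of `red τ`.
  refine ⟨fun τ π => P (red τ) π, ⟨⟨fun x : F × List Letter => v (red x.1, x.2), ?_, fun τ π => hvP _ _⟩,
    fun τ => ?_⟩, ?_, fun x => f (red x.1, tr x), ?_, fun τ π hQ => hfP _ _ (htr τ π hQ)⟩
  · exact hv.comp_prog (f := fun x : F × List Letter => (red x.1, x.2)) h₂
  · rw [← hsat, hunsat]
  · obtain ⟨T', q, hq, hT'⟩ := h₁.exists_precomp T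
    -- Computing `red τ` costs `q`, and `T` is charged for the length of `red τ`, itself at most
    -- `q`, plus the length of `π'`, which the summand `X` covers.
    refine ⟨T', q + p.comp (q + Polynomial.X), fun τ hτ => ?_⟩
    obtain ⟨π, hπ, hout⟩ := hT (red τ) (by rwa [hsat])
    refine ⟨π, hπ, fun π' hπ' => ?_⟩
    have H := (hT' τ π _ (hout π' hπ')).some
    refine ⟨⟨H.toEvalsTo, H.steps_le_m.trans ?_⟩⟩
    simp only [Polynomial.eval_add, Polynomial.eval_comp, Polynomial.eval_X]
    refine Nat.add_le_add (eval_le_eval _ (Nat.le_add_right _ _)) (eval_le_eval _ ?_)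
    have h₁ := hq τ
    have h₂ := eval_le_eval q (Nat.le_add_right (encF τ).length π'.length)
    omega
  · exact hf.comp_prog (f := fun x : F × List Letter => (red x.1, tr x)) h₃

/-! ### Translating refutations -/

section Transport

variable {M N : Type} {φ : Equation M → Equation N}

theorem Clause.toSet_map (φ : Equation M → Equation N) (D : Clause M) :
    Clause.toSet (D.map φ) = φ '' Clause.toSet D := by
  ext L; simp [Clause.toSet]

/-- Resolution uses only differences of equations, and simplification only the equations `0 = k`. A
map that respects both therefore carries each rule to an instance of the same rule. -/
theorem Step.map (hsub : ∀ L₁ L₂, φ (L₁ - L₂) = φ L₁ - φ L₂)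
    (hzero : ∀ k, φ (Equation.zeroEq M k) = Equation.zeroEq N k)
    {H P : Set (Set (Equation M))} {H' P' : Set (Set (Equation N))}
    (hH : ∀ D ∈ H, φ '' D ∈ H') (hP : ∀ D ∈ P, φ '' D ∈ P') {D : Set (Equation M)}
    (h : Step H P D) : Step H' P' (φ '' D) := by
  cases h with
  | initial h => exact .initial (hH _ h)
  | @resolution A B L₁ L₂ h₁ h₂ =>
    have h₁ := hP _ h₁
    have h₂ := hP _ h₂
    simp only [Set.image_union, Set.image_singleton, hsub] at h₁ h₂ ⊢
    exact .resolution h₁ h₂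
  | @weakening A L h =>
    simp only [Set.image_union, Set.image_singleton]
    exact .weakening _ (hP _ h)
  | @simplification _ k hk h =>
    have h := hP _ h
    simp only [Set.image_union, Set.image_singleton, hzero] at h
    exact .simplification hk h

/-- Axioms may land among the axioms or among the clauses of the new formula. The second option is
needed when products become variables, since the axioms about products are then no longer axioms. -/
theorem IsRefutation.map (hsub : ∀ L₁ L₂, φ (L₁ - L₂) = φ L₁ - φ L₂)
    (hzero : ∀ k, φ (Equation.zeroEq M k) = Equation.zeroEq N k)
    {Ax : Set (Set (Equation M))} {Ax' : Set (Set (Equation N))} {K : List (Clause M)}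
    {K' : List (Clause N)}
    (hAx : ∀ D ∈ Ax, φ '' D ∈ Ax' ∨ ∃ C ∈ K', φ '' D = Clause.toSet C)
    (hK : ∀ C ∈ K, C.map φ ∈ K') {π : List (Clause M)} (h : IsRefutation Ax K π) :
    IsRefutation Ax' K' (π.map (List.map φ)) := by
  refine ⟨fun ρ D σ hπ => ?_, by simp [List.getLast?_map, h.2]⟩
  obtain ⟨ρ', l, rfl, rfl, hl⟩ := List.map_eq_append_iff.1 hπ
  obtain ⟨D', σ', rfl, rfl, rfl⟩ := List.map_eq_cons_iff.1 hl
  rw [Clause.toSet_map]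
  refine (h.1 ρ' D' σ' rfl).map hsub hzero ?_ ?_
  · rintro E (⟨C, hC, rfl⟩ | hE)
    · exact Or.inl ⟨_, hK C hC, (Clause.toSet_map φ C).symm⟩
    · rcases hAx E hE with h | ⟨C, hC, h⟩
      · exact Or.inr h
      · exact Or.inl ⟨C, hC, h⟩
  · rintro E ⟨C, hC, rfl⟩
    exact ⟨_, List.mem_map_of_mem hC, (Clause.toSet_map φ C).symm⟩

end Transport

/-! ### Linear formulas as quadratic formulas -/

/-- A linear equation as a quadratic equation. -/
def toQuadEq {n : ℕ} (L : Equation (LinMonomial n)) : Equation (QuadMonomial n) :=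
  ⟨Sum.elim L.coeff 0, L.rhs⟩

theorem toQuadEq_sub {n : ℕ} (L₁ L₂ : Equation (LinMonomial n)) :
    toQuadEq (L₁ - L₂) = toQuadEq L₁ - toQuadEq L₂ := by
  ext m
  · rcases m with m | m
    · rfl
    · exact (sub_zero (0 : ℤ)).symm
  · rfl

theorem toQuadEq_zeroEq {n : ℕ} (k : ℤ) :
    toQuadEq (Equation.zeroEq (LinMonomial n) k) = Equation.zeroEq _ k := by
  ext m
  · rcases m with m | m <;> rfl
  · rfl

theorem toQuadEq_holds {n : ℕ} (a : Fin n → Bool) (L : Equation (LinMonomial n)) :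
    (toQuadEq L).Holds (QuadMonomial.val a) ↔ L.Holds (LinMonomial.val a) := by
  simp [Equation.Holds, toQuadEq, Fintype.sum_sum_type, QuadMonomial.val]

/-- A linear formula as a quadratic formula. -/
def toQuadFormula (τ : LinFormula) : QuadFormula := ⟨τ.n, τ.clauses.map (List.map toQuadEq)⟩

theorem toQuadFormula_satisfiable (τ : LinFormula) :
    (toQuadFormula τ).Satisfiable ↔ τ.Satisfiable := by
  refine exists_congr fun a => ?_
  refine List.forall_mem_map.trans (forall₂_congr fun D _ => ?_)
  constructor
  · rintro ⟨L, hL, h⟩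
    obtain ⟨L', hL', rfl⟩ := List.mem_map.1 hL
    exact ⟨L', hL', (toQuadEq_holds a L').1 h⟩
  · rintro ⟨L, hL, h⟩
    exact ⟨toQuadEq L, List.mem_map_of_mem hL, (toQuadEq_holds a L).2 h⟩

theorem toQuadEq_image_linAxioms {n : ℕ} {D : Set (Equation (LinMonomial n))}
    (h : D ∈ linAxioms n) : toQuadEq '' D ∈ quadAxioms n := by
  obtain ⟨i, rfl⟩ := h
  refine ⟨i, i, Or.inl ?_⟩
  have h (r : ℤ) : toQuadEq ⟨Pi.single i 1, r⟩ = ⟨quadVar i, r⟩ := by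
    ext m
    · rcases m with m | m
      · simp [toQuadEq, quadVar, Pi.single_apply]
      · simp [toQuadEq, quadVar]
    · rfl
  simp [boolEq, Set.image_insert_eq, h]

/-! ### Padding the encodings of linear equations -/

/-- One step of the padding of a string, from right to left. The flag says whether an end of an
equation has been read since the last comma, so that the next comma is the last one of an equation
and is to be repeated `k` times more. The letters that count are recognized by `cls`. -/
def padStep {A : Type} (cls : A → Option Letter) (k : ℕ) (a : A) (s : List A × Bool) :
    List A × Bool :=
  match cls a with
  | some .endEquation => (a :: s.1, true)
  | some .endClause => (a :: s.1, false)
  | some .comma => (a :: (bif s.2 then List.replicate k a ++ s.1 else s.1), false)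
  | _ => (a :: s.1, s.2)

/-- The string `l`, with the last comma of each equation repeated `k` times more. -/
def pad {A : Type} (cls : A → Option Letter) (k : ℕ) (l : List A) : List A :=
  (l.foldr (padStep cls k) ([], false)).1

/-- The number of the products `xᵢxⱼ`, `i ≤ j`. -/
def tri (n : ℕ) : ℕ := (n + 1).choose 2

theorem length_sym2_finRange (n : ℕ) : (List.finRange n).sym2.length = tri n := by
  simp [List.length_sym2, tri]

theorem tri_succ (n : ℕ) : tri (n + 1) = tri n + (n + 1) := by
  simp [tri, Nat.choose_succ_succ' (n + 1) 1]; ring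

theorem tri_le (n : ℕ) : tri n ≤ n * n := by
  induction n with
  | zero => simp [tri]
  | succ n ih => rw [tri_succ]; nlinarith

/-- The fold only prepends to its output, and its decisions depend only on the letters and the flag.
The old output thus factors out, and so does the tagging `f`. -/
theorem foldr_padStep_map {A : Type} {cls : A → Option Letter} {f : Letter → A}
    (hf : ∀ l, cls (f l) = some l) (k : ℕ) (out : List A) (b : Bool) (l : List Letter) :
    (l.map f).foldr (padStep cls k) (out, b) =
      ((l.foldr (padStep some k) ([], b)).1.map f ++ out,
        (l.foldr (padStep some k) ([], b)).2) := by
  induction l with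
  | nil => rfl
  | cons a l ih =>
    rw [List.map_cons, List.foldr_cons, List.foldr_cons, ih]
    cases a <;> simp only [padStep, hf, List.map_cons, List.cons_append]
    cases (List.foldr (padStep some k) ([], b) l).2 <;> simp

theorem foldr_padStep_of_none {A : Type} {cls : A → Option Letter} {f : Letter → A}
    (hf : ∀ l, cls (f l) = none) (k : ℕ) (s : List A × Bool) (l : List Letter) :
    (l.map f).foldr (padStep cls k) s = (l.map f ++ s.1, s.2) := by
  induction l with
  | nil => rfl
  | cons a l ih => simp [padStep, hf, ih]

theorem foldr_padStep_encodeInt (k : ℕ) (s : List Letter × Bool) (c : ℤ) :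
    (encodeInt c).foldr (padStep some k) s = (encodeInt c ++ s.1, s.2) := by
  unfold encodeInt
  induction c.natAbs with
  | zero => rfl
  | succ m ih =>
    rw [List.replicate_succ, List.foldr_cons, ih]
    split <;> rfl

theorem foldr_padStep_false {M : Type} (k : ℕ) (c : M → ℤ) (out : List Letter) (ms : List M) :
    (ms.flatMap fun m => encodeInt (c m) ++ [Letter.comma]).foldr (padStep some k) (out, false) =
      ((ms.flatMap fun m => encodeInt (c m) ++ [Letter.comma]) ++ out, false) := by
  induction ms with
  | nil => rfl
  | cons m ms ih =>
    rw [List.flatMap_cons, List.foldr_append, ih, List.foldr_append, List.foldr_cons,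
      List.foldr_nil, foldr_padStep_encodeInt]
    simp [padStep]

/-- The comma met first from the right is the one that closes the last coefficient. It receives the
padding and lowers the flag, so the others stay single. Without monomials there would be no comma to
pad. -/
theorem foldr_padStep_true {M : Type} (k : ℕ) (c : M → ℤ) (out : List Letter) {ms : List M}
    (h : ms ≠ []) :
    (ms.flatMap fun m => encodeInt (c m) ++ [Letter.comma]).foldr (padStep some k) (out, true) =
      ((ms.flatMap fun m => encodeInt (c m) ++ [Letter.comma]) ++
        (List.replicate k Letter.comma ++ out), false) := by
  obtain ⟨ms', m, rfl⟩ := (List.eq_nil_or_concat ms).resolve_left h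
  have h₁ : (encodeInt (c m) ++ [Letter.comma]).foldr (padStep some k) (out, true) =
      (encodeInt (c m) ++ Letter.comma :: (List.replicate k Letter.comma ++ out), false) := by
    rw [List.foldr_append, List.foldr_cons, List.foldr_nil, foldr_padStep_encodeInt]
    simp [padStep]
  rw [List.concat_eq_append, List.flatMap_append, List.foldr_append, List.flatMap_singleton, h₁,
    foldr_padStep_false]
  simp

/-- Zero is the empty string in unary, so the vanishing product coefficients contribute one block of
`tri n` bare commas before the right-hand side. -/
theorem encodeEquation_toQuadEq {n : ℕ} (L : Equation (LinMonomial n)) :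
    encodeEquation (quadMonomials n) (toQuadEq L) =
      ((linMonomials n).flatMap fun m => encodeInt (L.coeff m) ++ [Letter.comma]) ++
        (List.replicate (tri n) Letter.comma ++ (encodeInt L.rhs ++ [Letter.endEquation])) := by
  have h : (List.finRange n).sym2.flatMap (fun _ => [Letter.comma]) =
      List.replicate (tri n) Letter.comma := by
    rw [← length_sym2_finRange]
    induction (List.finRange n).sym2 with
    | nil => rfl
    | cons z l ih => rw [List.flatMap_cons, ih]; rfl
  simp [encodeEquation, quadMonomials, toQuadEq, encodeInt, linMonomials, List.flatMap_map, h]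
  rfl

theorem foldr_padStep_encodeEquation {n : ℕ} (L : Equation (LinMonomial n))
    (s : List Letter × Bool) :
    ∃ b, (encodeEquation (linMonomials n) L).foldr (padStep some (tri n)) s =
      (encodeEquation (quadMonomials n) (toQuadEq L) ++ s.1, b) := by
  have h : (encodeInt L.rhs ++ [Letter.endEquation]).foldr (padStep some (tri n)) s =
      (encodeInt L.rhs ++ Letter.endEquation :: s.1, true) := by
    rw [List.foldr_append, List.foldr_cons, List.foldr_nil, foldr_padStep_encodeInt]
    simp [padStep]
  rw [encodeEquation_toQuadEq, encodeEquation, List.append_assoc, List.foldr_append, h]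
  rcases n with _ | n
  -- Without variables there are no commas, so the flag stays raised. This is harmless since `tri 0
  -- = 0`, and it is why the final flag is left unspecified.
  · exact ⟨true, by simp [linMonomials, tri]⟩
  · refine ⟨false, ?_⟩
    rw [foldr_padStep_true _ _ _ (by simp [linMonomials])]
    simp

theorem foldr_padStep_encodeClause {n : ℕ} (D : Clause (LinMonomial n)) (s : List Letter × Bool) :
    ∃ b, (encodeClause (linMonomials n) D).foldr (padStep some (tri n)) s =
      (encodeClause (quadMonomials n) (D.map toQuadEq) ++ s.1, b) := by
  induction D with
  | nil => exact ⟨false, rfl⟩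
  | cons L D ih =>
    obtain ⟨b, hb⟩ := ih
    simp only [encodeClause] at hb ⊢
    rw [List.flatMap_cons, List.append_assoc, List.foldr_append, hb]
    obtain ⟨b', hb'⟩ := foldr_padStep_encodeEquation L
      (List.flatMap (encodeEquation (quadMonomials n)) (D.map toQuadEq) ++ [.endClause] ++ s.1, b)
    exact ⟨b', by rw [hb']; simp⟩

theorem foldr_padStep_encodeLines {n : ℕ} (π : List (Clause (LinMonomial n)))
    (s : List Letter × Bool) :
    ∃ b, (encodeLines (linMonomials n) π).foldr (padStep some (tri n)) s =
      (encodeLines (quadMonomials n) (π.map (List.map toQuadEq)) ++ s.1, b) := by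
  induction π with
  | nil => exact ⟨s.2, rfl⟩
  | cons D π ih =>
    obtain ⟨b, hb⟩ := ih
    simp only [encodeLines] at hb ⊢
    rw [List.flatMap_cons, List.foldr_append, hb]
    obtain ⟨b', hb'⟩ := foldr_padStep_encodeClause D
      ((π.map (List.map toQuadEq)).flatMap (encodeClause (quadMonomials n)) ++ s.1, b)
    exact ⟨b', by rw [hb']; simp⟩

theorem pad_encodeLines {n : ℕ} (π : List (Clause (LinMonomial n))) :
    pad some (tri n) (encodeLines (linMonomials n) π) =
      encodeLines (quadMonomials n) (π.map (List.map toQuadEq)) := by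
  obtain ⟨b, hb⟩ := foldr_padStep_encodeLines π ([], false)
  rw [pad, hb, List.append_nil]

theorem RLin.rQuad {τ : LinFormula} {s : List Letter} (h : RLin τ s) :
    RQuad (toQuadFormula τ) (pad some (tri τ.n) s) := by
  obtain ⟨π, hπ, rfl⟩ := h
  refine ⟨π.map (List.map toQuadEq), ?_, (pad_encodeLines π).symm⟩
  exact hπ.map toQuadEq_sub toQuadEq_zeroEq (fun D hD => .inl (toQuadEq_image_linAxioms hD))
    fun C hC => List.mem_map_of_mem hC

/-- The fold meets the refutation before the formula and reaches the formula with some flag `b`.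
That flag is immaterial because every encoded clause ends with a letter that sets it anew. -/
theorem pad_append {A : Type} {cls : A → Option Letter} {f g : Letter → A}
    (hf : ∀ l, cls (f l) = some l) {n : ℕ} (K : List (Clause (LinMonomial n))) {l l' : List Letter}
    {b : Bool} (hl : (l.map g).foldr (padStep cls (tri n)) ([], false) = (l'.map g, b)) :
    pad cls (tri n) ((encodeLines (linMonomials n) K).map f ++ l.map g) =
      (encodeLines (quadMonomials n) (K.map (List.map toQuadEq))).map f ++ l'.map g := by
  rw [pad, List.foldr_append, hl, foldr_padStep_map hf]
  obtain ⟨b', hb'⟩ := foldr_padStep_encodeLines K ([], b)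
  rw [hb', List.append_nil]

theorem encode_toQuadFormula (τ : LinFormula) :
    QuadFormula.encode (toQuadFormula τ) = List.replicate τ.n Letter.plus ++ Letter.endClause ::
      pad some (tri τ.n) (encodeLines (linMonomials τ.n) τ.clauses) := by
  rw [pad_encodeLines]
  rfl

theorem encodePair_toQuadFormula (τ : LinFormula) (π : List Letter) :
    encodePair QuadFormula.encode (toQuadFormula τ, π) =
      List.replicate τ.n (Sum.inl Letter.plus) ++ Sum.inl Letter.endClause ::
        pad (Sum.elim some fun _ => none) (tri τ.n)
          ((encodeLines (linMonomials τ.n) τ.clauses).map Sum.inl ++ π.map Sum.inr) := by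
  rw [pad_append (f := Sum.inl) (g := Sum.inr) (l' := π) (b := false) (fun _ => rfl) τ.clauses
    (by rw [foldr_padStep_of_none (fun _ => rfl), List.append_nil]), encodePair,
    encode_toQuadFormula, pad_encodeLines]
  simp

theorem encodePair_toQuadFormula_pad (τ : LinFormula) (π : List Letter) :
    encodePair QuadFormula.encode (toQuadFormula τ, pad some (tri τ.n) π) =
      List.replicate τ.n (Sum.inl Letter.plus) ++ Sum.inl Letter.endClause ::
        pad (Sum.elim some some) (tri τ.n)
          ((encodeLines (linMonomials τ.n) τ.clauses).map Sum.inl ++ π.map Sum.inr) := by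
  rw [pad_append (f := Sum.inl) (g := Sum.inr) (l' := pad some (tri τ.n) π)
    (b := (π.foldr (padStep some (tri τ.n)) ([], false)).2) (fun _ => rfl) τ.clauses
    (by rw [foldr_padStep_map (f := Sum.inr) (fun _ => rfl), List.append_nil]; rfl), encodePair,
    encode_toQuadFormula, pad_encodeLines]
  simp

namespace Prog

/-! ### Basic programs -/

section Basic

variable {J A : Type} [DecidableEq J] {p q : Prog J A} {S S' S'' : J → List A} {t t' : ℕ}

theorem RunsIn.mono (h : RunsIn p S S' t) (ht : t ≤ t') : RunsIn p S S' t' :=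
  h.imp fun _ h => ⟨h.1.trans ht, h.2⟩

theorem RunsIn.congr (h : RunsIn p S S' t) (hS : S' = S'') (ht : t ≤ t') : RunsIn p S S'' t' :=
  hS ▸ h.mono ht

theorem RunsIn.seq (h : RunsIn p S S' t) (h' : RunsIn q S' S'' t') :
    RunsIn (.seq p q) S S'' (t + t') := by
  obtain ⟨s, hs, h⟩ := h
  obtain ⟨s', hs', h'⟩ := h'
  exact ⟨_, Nat.add_le_add hs hs', h.seq h'⟩

theorem RunsIn.length_le (h : RunsIn p S S' t) (k : J) :
    (S' k).length ≤ (S k).length + t := by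
  obtain ⟨s, hs, h⟩ := h
  exact (h.length_le k).trans (Nat.add_le_add_left hs _)

theorem runsIn_push (j : J) (a : A) (S : J → List A) :
    RunsIn (.push j a) S (update S j (a :: S j)) 1 := ⟨1, le_rfl, .push j a S⟩

theorem runsIn_pop (j : J) (S : J → List A) :
    RunsIn (.pop j) S (update S j (S j).tail) 1 := ⟨1, le_rfl, .pop j S⟩

theorem runsIn_loop_nil {j : J} {c : A → Bool} {b : A → Prog J A} (h : S j = []) :
    RunsIn (.loop j c b) S S 1 := ⟨1, le_rfl, .loop_nil h⟩

theorem runsIn_loop_exit {j : J} {c : A → Bool} {b : A → Prog J A} {a : A} {l : List A}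
    (h : S j = a :: l) (hc : c a = false) : RunsIn (.loop j c b) S (update S j l) 1 :=
  ⟨1, le_rfl, .loop_exit h hc⟩

theorem RunsIn.loop_step {j : J} {c : A → Bool} {b : A → Prog J A} {a : A} {l : List A}
    (h : S j = a :: l) (hc : c a = true) (h₁ : RunsIn (b a) (update S j l) S' t)
    (h₂ : RunsIn (.loop j c b) S' S'' t') : RunsIn (.loop j c b) S S'' (1 + t + t') := by
  obtain ⟨s, hs, h₁⟩ := h₁
  obtain ⟨s', hs', h₂⟩ := h₂
  exact ⟨_, Nat.add_le_add (Nat.add_le_add_left hs 1) hs', .loop_step h hc h₁ h₂⟩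

/-- Run `b a` for the letters `a` of the stack `j`, from the top. -/
def forEach (j : J) (b : A → Prog J A) : Prog J A := .loop j (fun _ => true) b

/-- A loop over a stack, where `T l` are the stacks when `l` remains. -/
theorem runsIn_forEach {j : J} {b : A → Prog J A} (T : List A → J → List A) (l : List A)
    (hT : ∀ l, T l j = l)
    (h : ∀ a l', a :: l' <:+ l → RunsIn (b a) (update (T (a :: l')) j l') (T l') t) :
    RunsIn (forEach j b) (T l) (T []) (l.length * (t + 1) + 1) := by
  induction l with
  | nil => exact (runsIn_loop_nil (hT [])).mono (by simp)
  | cons a l ih =>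
    refine (RunsIn.loop_step (hT _) rfl (h a l List.suffix_rfl)
      (ih fun a' l' h' => h a' l' (h'.trans (List.suffix_cons a l)))).mono ?_
    rw [List.length_cons]
    ring_nf
    rfl

/-- Move the stack `x` onto the stack `y`. -/
def move (x y : J) : Prog J A := forEach x fun a => .push y a

theorem runsIn_move {x y : J} (hxy : x ≠ y) (l : List A) : ∀ S : J → List A, S x = l →
    RunsIn (move x y) S (update (update S x []) y (l.reverse ++ S y)) (2 * l.length + 1) := by
  induction l with
  | nil =>
    intro S hS
    have h : update (update S x []) y (S y) = S := by
      rw [← hS, update_eq_self, update_eq_self]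
    simpa [h, move, forEach] using runsIn_loop_nil (b := fun a => .push y a) (c := fun _ => true) hS
  | cons a l ih =>
    intro S hS
    refine (RunsIn.loop_step hS rfl (runsIn_push y a _) (ih _ ?_)).congr ?_ ?_
    · rw [update_of_ne hxy, update_self]
    · funext k
      by_cases hy : k = y
      · subst hy; simp [update_of_ne hxy.symm]
      · by_cases hx : k = x
        · subst hx; simp [update_of_ne hy]
        · simp [update_of_ne hy, update_of_ne hx]
    · rw [List.length_cons]; omega

/-- Empty the stack `x`; the stack `z` is empty. -/
def clear (x z : J) : Prog J A := forEach x fun _ => .pop z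

theorem runsIn_clear {x z : J} (hxz : x ≠ z) (l : List A) : ∀ S : J → List A, S x = l →
    S z = [] → RunsIn (clear x z) S (update S x []) (2 * l.length + 1) := by
  induction l with
  | nil =>
    intro S hS _
    have h : update S x [] = S := by rw [← hS, update_eq_self]
    simpa [h, clear, forEach] using runsIn_loop_nil (b := fun _ => .pop z) (c := fun _ => true) hS
  | cons a l ih =>
    intro S hS hz
    -- The loop body pops the empty stack `z`, which serves as a step without effect.
    have h : update (update S x l) z (update S x l z).tail = update S x l := by
      conv_rhs => rw [← update_eq_self z (update S x l)]
      rw [update_of_ne hxz.symm, hz]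
      rfl
    have h₁ := runsIn_pop z (update S x l)
    rw [h] at h₁
    have h₂ := ih (update S x l) (update_self ..) (by rw [update_of_ne hxz.symm, hz])
    rw [update_idem] at h₂
    refine (RunsIn.loop_step hS rfl h₁ h₂).mono ?_
    rw [List.length_cons]; omega

/-- Push as many letters `a` on the stack `y` as the stack `x` contains; the stack `z` is empty. -/
def emit (x y z : J) (a : A) : Prog J A :=
  .seq (forEach x fun b => .seq (.push z b) (.push y a)) (move z x)

theorem runsIn_emit_aux {x y z : J} (hxy : x ≠ y) (hxz : x ≠ z) (hyz : y ≠ z) (a : A)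
    (l : List A) : ∀ S : J → List A, S x = l →
      RunsIn (forEach x fun b => .seq (.push z b) (.push y a)) S
        (update (update (update S x []) z (l.reverse ++ S z)) y
          (List.replicate l.length a ++ S y)) (3 * l.length + 1) := by
  induction l with
  | nil =>
    intro S hS
    have h : update (update (update S x []) z (S z)) y (S y) = S := by
      rw [← hS, update_eq_self, update_eq_self, update_eq_self]
    simpa [h, forEach] using runsIn_loop_nil (b := fun b => .seq (.push z b) (.push y a))
      (c := fun _ => true) hS
  | cons b l ih =>
    intro S hS
    refine (RunsIn.loop_step hS rfl ((runsIn_push z b _).seq (runsIn_push y a _))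
      (ih _ ?_)).congr ?_ ?_
    · simp [update_of_ne hxy, update_of_ne hxz]
    · funext k
      by_cases hy : k = y
      · subst hy
        simp [update_of_ne hxy.symm, update_of_ne hyz, List.replicate_succ']
      · by_cases hz : k = z
        · subst hz; simp [update_of_ne hy, update_of_ne hxz.symm]
        · by_cases hx : k = x
          · subst hx; simp [update_of_ne hy, update_of_ne hz]
          · simp [update_of_ne hy, update_of_ne hx, update_of_ne hz]
    · rw [List.length_cons]; omega

/-- Counting empties `x` onto `z`, and moving it back undoes the reversal. The counter survives
intact and can be read again. -/
theorem runsIn_emit {x y z : J} (hxy : x ≠ y) (hxz : x ≠ z) (hyz : y ≠ z) (a : A) {m : ℕ}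
    (S : J → List A) (hx : (S x).length = m) (hz : S z = []) :
    RunsIn (emit x y z a) S (update S y (List.replicate m a ++ S y)) (5 * m + 2) := by
  refine ((runsIn_emit_aux hxy hxz hyz a (S x) S rfl).seq (runsIn_move hxz.symm
    (S x).reverse _ ?_)).congr ?_ ?_
  · simp [update_of_ne hyz.symm, hz]
  · funext k
    by_cases hxk : k = x
    · subst hxk; simp [update_of_ne hxy, update_of_ne hxz]
    · by_cases hzk : k = z
      · subst hzk; simp [update_of_ne hxk, update_of_ne hyz.symm, hz]
      · by_cases hyk : k = y
        · subst hyk; simp [update_of_ne hxk, update_of_ne hzk, hx]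
        · simp [update_of_ne hxk, update_of_ne hzk, update_of_ne hyk]
  · simp only [List.length_reverse]; omega

end Basic

/-! ### A fixed set of stacks -/

/-- The names of the stacks. -/
inductive Stk
  | inp | n | r | t | c₁ | c₂ | c₃ | q | tmp | out
  deriving DecidableEq

instance : Fintype Stk :=
  ⟨{.inp, .n, .r, .t, .c₁, .c₂, .c₃, .q, .tmp, .out}, fun x => by cases x <;> simp⟩

variable {A : Type}

/-- Stacks with given contents. -/
def stk (inp n r t c₁ c₂ c₃ q tmp out : List A) : Stk → List A
  | .inp => inp
  | .n => n
  | .r => r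
  | .t => t
  | .c₁ => c₁
  | .c₂ => c₂
  | .c₃ => c₃
  | .q => q
  | .tmp => tmp
  | .out => out

section

variable (inp n r t c₁ c₂ c₃ q tmp out l : List A)

@[simp] theorem update_stk_inp : update (stk inp n r t c₁ c₂ c₃ q tmp out) .inp l =
    stk l n r t c₁ c₂ c₃ q tmp out := by funext k; cases k <;> rfl

@[simp] theorem update_stk_n : update (stk inp n r t c₁ c₂ c₃ q tmp out) .n l =
    stk inp l r t c₁ c₂ c₃ q tmp out := by funext k; cases k <;> rfl

@[simp] theorem update_stk_r : update (stk inp n r t c₁ c₂ c₃ q tmp out) .r l =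
    stk inp n l t c₁ c₂ c₃ q tmp out := by funext k; cases k <;> rfl

@[simp] theorem update_stk_t : update (stk inp n r t c₁ c₂ c₃ q tmp out) .t l =
    stk inp n r l c₁ c₂ c₃ q tmp out := by funext k; cases k <;> rfl

@[simp] theorem update_stk_c₁ : update (stk inp n r t c₁ c₂ c₃ q tmp out) .c₁ l =
    stk inp n r t l c₂ c₃ q tmp out := by funext k; cases k <;> rfl

@[simp] theorem update_stk_c₂ : update (stk inp n r t c₁ c₂ c₃ q tmp out) .c₂ l =
    stk inp n r t c₁ l c₃ q tmp out := by funext k; cases k <;> rfl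

@[simp] theorem update_stk_c₃ : update (stk inp n r t c₁ c₂ c₃ q tmp out) .c₃ l =
    stk inp n r t c₁ c₂ l q tmp out := by funext k; cases k <;> rfl

@[simp] theorem update_stk_q : update (stk inp n r t c₁ c₂ c₃ q tmp out) .q l =
    stk inp n r t c₁ c₂ c₃ l tmp out := by funext k; cases k <;> rfl

@[simp] theorem update_stk_out : update (stk inp n r t c₁ c₂ c₃ q tmp out) .out l =
    stk inp n r t c₁ c₂ c₃ q tmp l := by funext k; cases k <;> rfl

theorem single_inp : single .inp l = stk l [] [] [] [] [] [] [] [] [] := by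
  funext k; cases k <;> rfl

theorem single_out : single .out l = stk [] [] [] [] [] [] [] [] [] l := by
  funext k; cases k <;> rfl

end

variable {A : Type}

/-! ### The number of variables -/

/-- Read letters `a`, with copies to the stack `n`, and one more letter. -/
def header [DecidableEq A] (a : A) : Prog Stk A := .loop .inp (fun b => b = a) fun _ => .push .n a

theorem runsIn_header [DecidableEq A] {a b : A} (hab : b ≠ a) (rest : List A) (m : ℕ) :
    RunsIn (header a) (single .inp (List.replicate m a ++ b :: rest))
      (stk rest (List.replicate m a) [] [] [] [] [] [] [] []) (2 * m + 1) := by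
  have h (l : List A) : RunsIn (header a)
      (stk (List.replicate m a ++ b :: rest) l [] [] [] [] [] [] [] [])
      (stk rest (List.replicate m a ++ l) [] [] [] [] [] [] [] []) (2 * m + 1) := by
    induction m generalizing l with
    | zero =>
      refine (runsIn_loop_exit (j := Stk.inp) (c := fun b => b = a) (a := b) (l := rest) rfl (by simpa using hab)).congr ?_ ?_ <;> simp
    | succ m ih =>
      refine (RunsIn.loop_step (a := a) (l := List.replicate m a ++ b :: rest) (t := 1)
        (S' := stk (List.replicate m a ++ b :: rest) (a :: l) [] [] [] [] [] [] [] [])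
        rfl (by simp) ?_ (ih (a :: l))).congr ?_ ?_
      · refine (runsIn_push Stk.n a _).congr ?_ le_rfl
        simp [stk]
      · simp [List.replicate_succ']
      · omega
  rw [single_inp]
  simpa using h []

/-- Move `m` letters from the stack `n` to the stack `r`, with `tri m` letters on the stack `t`. -/
def triangle (a : A) : Prog Stk A := forEach .n fun _ => .seq (.push .r a) (emit .r .t .tmp a)

/-- The recursion `tri (k + 1) = tri k + (k + 1)`: each pass lengthens `r` by one letter and then
adds the length of `r` to `t`. -/
theorem runsIn_triangle (a : A) (m : ℕ) (rest : List A) :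
    RunsIn (triangle a) (stk rest (List.replicate m a) [] [] [] [] [] [] [] [])
      (stk rest [] (List.replicate m a) (List.replicate (tri m) a) [] [] [] [] [] [])
      (m * (5 * m + 4) + 1) := by
  let T : List A → Stk → List A := fun l => stk rest l (List.replicate (m - l.length) a)
    (List.replicate (tri (m - l.length)) a) [] [] [] [] [] []
  have h := runsIn_forEach (j := Stk.n) (b := fun _ => .seq (.push .r a) (emit .r .t .tmp a))
    (t := 5 * m + 3) T (List.replicate m a) (fun _ => rfl) fun b l hl => ?_
  · have e : T (List.replicate m a) =
        stk rest (List.replicate m a) [] [] [] [] [] [] [] [] := by simp [T, tri]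
    rw [e] at h
    exact h.congr (by simp [T]) (by simp)
  · have hlen : l.length + 1 ≤ m := by simpa using hl.length_le
    obtain ⟨k, rfl⟩ := Nat.exists_eq_add_of_le hlen
    have e₁ : l.length + 1 + k - (l.length + 1) = k := by omega
    have e₂ : l.length + 1 + k - l.length = k + 1 := by omega
    refine ((runsIn_push Stk.r a _).seq (runsIn_emit (x := Stk.r) (y := .t) (z := .tmp) (m := k + 1)
      (by simp) (by simp) (by simp) a _ ?_ ?_)).congr ?_ ?_
    · simp [T, stk, e₁]
    · simp [T, stk]
    · simp only [T, List.length_cons, e₁, e₂, update_stk_n, update_stk_r, update_stk_t, stk,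
        tri_succ, List.replicate_succ]
      rw [← List.replicate_succ, List.replicate_append_replicate, Nat.add_comm (k + 1)]
    · omega

/-! ### Padding -/

/-- The padding of a string that is read from the stack `c₁`, with the flag on the stack `c₂`, the
result on the stack `c₃`, and as many letters on the stack `t` as commas are to be added. -/
def padBody (cls : A → Option Letter) (mark : A) (a : A) : Prog Stk A :=
  match cls a with
  | some .endEquation => .seq (.pop .c₂) (.seq (.push .c₂ mark) (.push .c₃ a))
  | some .endClause => .seq (.pop .c₂) (.push .c₃ a)
  | some .comma => .seq (forEach .c₂ fun _ => emit .t .c₃ .tmp a) (.push .c₃ a)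
  | _ => .push .c₃ a

/-- The stacks during the padding. -/
def padState (r t : List A) (mark : A) (l : List A) (s : List A × Bool) : Stk → List A :=
  stk [] [] r t l (bif s.2 then [mark] else []) s.1 [] [] []

/-- The flag is raised when `c₂` holds one marker. A loop over `c₂` then acts as a conditional that
also lowers the flag, and the pop before each push keeps the number of markers at most one. -/
theorem runsIn_padBody (cls : A → Option Letter) (mark a : A) (r t l : List A)
    (s : List A × Bool) :
    RunsIn (padBody cls mark a) (padState r t mark l s)
      (padState r t mark l (padStep cls t.length a s)) (5 * t.length + 6) := by
  obtain ⟨o, b⟩ := s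
  have hpush (l' : List A) : RunsIn (.push .c₃ a) (stk [] [] r t l l' o [] [] [])
      (stk [] [] r t l l' (a :: o) [] [] []) 1 := (runsIn_push _ _ _).congr (by simp [stk]) le_rfl
  have hpop : RunsIn (.pop .c₂) (padState r t mark l (o, b)) (stk [] [] r t l [] o [] [] []) 1 := by
    refine (runsIn_pop _ _).congr ?_ le_rfl
    cases b <;> simp [padState, stk]
  unfold padBody padStep
  rcases cls a with _ | _ | _ | _ | _ | _
  · exact (hpush _).mono (by omega)
  · exact (hpush _).mono (by omega)
  · exact (hpush _).mono (by omega)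
  · cases b
    · exact RunsIn.mono (t := 2) ((runsIn_loop_nil rfl).seq (hpush [])) (by omega)
    · have h₁ : RunsIn (emit .t .c₃ .tmp a) (stk [] [] r t l [] o [] [] [])
          (stk [] [] r t l [] (List.replicate t.length a ++ o) [] [] []) (5 * t.length + 2) :=
        (runsIn_emit (by simp) (by simp) (by simp) a _ rfl rfl).congr (by simp [stk]) le_rfl
      have h₂ : RunsIn (forEach .c₂ fun _ => emit .t .c₃ .tmp a)
          (padState r t mark l (o, true))
          (stk [] [] r t l [] (List.replicate t.length a ++ o) [] [] [])
          (1 + (5 * t.length + 2) + 1) := by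
        refine RunsIn.loop_step (a := mark) (l := []) rfl rfl ?_ (runsIn_loop_nil rfl)
        simpa [padState] using h₁
      refine (h₂.seq (runsIn_push Stk.c₃ a _)).congr ?_ ?_
      · simp [padState, stk]
      · omega
  · refine (hpop.seq ((runsIn_push Stk.c₂ mark _).seq (runsIn_push Stk.c₃ a _))).congr ?_ (by omega)
    simp [padState, stk]
  · exact (hpop.seq (hpush [])).mono (by omega)

/-- Once the input has been moved to `c₁`, its last letter is on top. Popping `c₁` and pushing on
`c₃` therefore performs the fold from the right. -/
theorem runsIn_forEach_padBody (cls : A → Option Letter) (mark : A) (r t l : List A) :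
    ∀ s : List A × Bool, RunsIn (forEach .c₁ (padBody cls mark)) (padState r t mark l s)
      (padState r t mark [] (l.reverse.foldr (padStep cls t.length) s))
      (l.length * (5 * t.length + 7) + 1) := by
  induction l with
  | nil => exact fun s => (runsIn_loop_nil rfl).mono (by simp)
  | cons a l ih =>
    intro s
    refine (RunsIn.loop_step (a := a) (l := l) (t := 5 * t.length + 6)
      (S' := padState r t mark l (padStep cls t.length a s)) rfl rfl ?_ (ih _)).congr ?_ ?_
    · rw [padState, update_stk_c₁]
      exact runsIn_padBody cls mark a r t l s
    · simp
    · rw [List.length_cons]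
      ring_nf; rfl

/-- The program for the padding. -/
def padProg [DecidableEq A] (cls : A → Option Letter) (a b : A) : Prog Stk A :=
  .seq (.seq (header a) (.seq (triangle a) (.seq (move .inp .c₁) (.seq (forEach .c₁ (padBody cls a))
    (.seq (.push .c₃ b) (.seq (emit .r .c₃ .tmp a) (.seq (clear .r .tmp) (.seq (clear .t .tmp)
      (.pop .c₂))))))))) (move .c₃ .out)

/-- The shape of the bound on the time of the padding, in the length `N` of the string. -/
def padTime (N : ℕ) : ℕ :=
  2 * N + 1 + (N * (5 * N + 4) + 1 + (2 * N + 1 + (N * (5 * (N * N) + 7) + 1 + (1 + (5 * N + 2 +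
    (2 * N + 1 + (2 * (N * N) + 1 + 1)))))))

theorem runsIn_padProg [DecidableEq A] {cls : A → Option Letter} {a b : A} (hab : b ≠ a) (m : ℕ)
    (rest : List A) :
    RunsIn (padProg cls a b) (single .inp (List.replicate m a ++ b :: rest))
      (single .out (List.replicate m a ++ b :: pad cls (tri m) rest).reverse)
      (3 * padTime (List.replicate m a ++ b :: rest).length + 1) := by
  set N := (List.replicate m a ++ b :: rest).length with hN
  have hm : m ≤ N := by simp [hN]
  have hrest : rest.length ≤ N := by simp [hN]; omega
  have htri : tri m ≤ N * N := (tri_le m).trans (Nat.mul_le_mul hm hm)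
  obtain ⟨fl, hfl⟩ : ∃ fl, rest.foldr (padStep cls (tri m)) ([], false) =
      (pad cls (tri m) rest, fl) := ⟨_, rfl⟩
  have h₁ := runsIn_header hab rest m
  have h₂ := runsIn_triangle a m rest
  have h₃ : RunsIn (move .inp .c₁) (stk rest [] (List.replicate m a) (List.replicate (tri m) a)
      [] [] [] [] [] []) (padState (List.replicate m a) (List.replicate (tri m) a) a rest.reverse
      ([], false)) (2 * rest.length + 1) :=
    (runsIn_move (by simp) rest _ rfl).congr (by simp [padState, stk]) le_rfl
  have h₄ := runsIn_forEach_padBody cls a (List.replicate m a) (List.replicate (tri m) a)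
    rest.reverse ([], false)
  rw [List.reverse_reverse, List.length_reverse, List.length_replicate, hfl] at h₄
  have h₅ := runsIn_push Stk.c₃ b (padState (List.replicate m a) (List.replicate (tri m) a) a []
    (pad cls (tri m) rest, fl))
  have h₆ := runsIn_emit (x := Stk.r) (y := .c₃) (z := .tmp) (m := m) (by simp) (by simp) (by simp)
    a (update (padState (List.replicate m a) (List.replicate (tri m) a) a []
      (pad cls (tri m) rest, fl)) .c₃ (b :: pad cls (tri m) rest))
    (by simp [padState, stk]) (by simp [padState, stk])
  have h₇ := runsIn_clear (x := Stk.r) (z := .tmp) (by simp) (List.replicate m a)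
    (stk [] [] (List.replicate m a) (List.replicate (tri m) a) [] (bif fl then [a] else [])
      (List.replicate m a ++ b :: pad cls (tri m) rest) [] [] []) rfl rfl
  have h₈ := runsIn_clear (x := Stk.t) (z := .tmp) (by simp) (List.replicate (tri m) a)
    (stk [] [] [] (List.replicate (tri m) a) [] (bif fl then [a] else [])
      (List.replicate m a ++ b :: pad cls (tri m) rest) [] [] []) rfl rfl
  have h₉ := runsIn_pop Stk.c₂ (stk [] [] [] [] [] (bif fl then [a] else [])
      (List.replicate m a ++ b :: pad cls (tri m) rest) [] [] [])
  have e₉ : update (stk [] [] [] [] [] (bif fl then [a] else [])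
      (List.replicate m a ++ b :: pad cls (tri m) rest) [] [] []) .c₂ (stk [] [] [] [] []
      (bif fl then [a] else []) (List.replicate m a ++ b :: pad cls (tri m) rest) [] [] []
      .c₂).tail =
      stk [] [] [] [] [] [] (List.replicate m a ++ b :: pad cls (tri m) rest) [] [] [] := by
    cases fl <;> simp [stk]
  rw [e₉] at h₉
  simp only [padState, update_stk_c₃, update_stk_r, update_stk_t, List.length_replicate] at *
  have h := h₁.seq (h₂.seq (h₃.seq (h₄.seq (h₅.seq (h₆.seq (h₇.seq (h₈.seq h₉)))))))
  have hT := h.mono (t' := padTime N) (by unfold padTime; gcongr)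
  -- The result is no longer than the time spent so far. The final move costs twice this length plus
  -- one, hence the bound `3 * padTime _ + 1`.
  have hlen := hT.length_le .c₃
  have h₁₀ := runsIn_move (x := Stk.c₃) (y := .out) (by simp) _
    (stk [] [] [] [] [] [] (List.replicate m a ++ b :: pad cls (tri m) rest) [] [] []) rfl
  refine (hT.seq h₁₀).congr ?_ ?_
  · simp [single_out, stk]
  · rw [single_inp] at hlen
    simp only [stk, List.length_nil] at hlen ⊢
    omega

theorem progTransforms_pad [DecidableEq A] {α : Type} {cls : A → Option Letter} {a b : A}
    (hab : b ≠ a) {ea eb : α → List A} (n : α → ℕ) (rest : α → List A)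
    (hea : ∀ x, ea x = List.replicate (n x) a ++ b :: rest x)
    (heb : ∀ x, eb x = List.replicate (n x) a ++ b :: pad cls (tri (n x)) (rest x)) :
    ProgTransforms ea eb := by
  refine ⟨Stk, inferInstance, inferInstance, padProg cls a b, .inp, .out,
    3 * (2 * .X + 1 + (.X * (5 * .X + 4) + 1 + (2 * .X + 1 + (.X * (5 * (.X * .X) + 7) + 1 + (1 +
    (5 * .X + 2 + (2 * .X + 1 + (2 * (.X * .X) + 1 + 1)))))))) + 1, fun x => ?_⟩
  rw [hea, heb]
  refine (runsIn_padProg hab (n x) (rest x)).mono (le_of_eq ?_)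
  simp [padTime]

end Prog

/-! ### From R(quad) to R(lin) -/

theorem encode_eq {M : ℕ → Type} (ms : ∀ n, List (M n)) (τ : Formula M) :
    Formula.encode ms τ = List.replicate τ.n Letter.plus ++ Letter.endClause ::
      encodeLines (ms τ.n) τ.clauses := rfl

theorem encodePair_eq {M : ℕ → Type} (ms : ∀ n, List (M n)) (x : Formula M × List Letter) :
    encodePair (Formula.encode ms) x = List.replicate x.1.n (Sum.inl Letter.plus) ++
      Sum.inl Letter.endClause ::
        ((encodeLines (ms x.1.n) x.1.clauses).map Sum.inl ++ x.2.map Sum.inr) := by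
  simp [encodePair, Formula.encode]

theorem weaklyAutomatizable_rLin_of_rQuad
    (h : WeaklyAutomatizable QuadFormula.encode QuadFormula.Satisfiable RQuad) :
    WeaklyAutomatizable LinFormula.encode LinFormula.Satisfiable RLin := by
  refine h.of_reduction toQuadFormula (fun x => pad some (tri x.1.n) x.2)
    toQuadFormula_satisfiable (fun τ π hπ => hπ.rQuad) ?_ ?_ ?_
  · exact Prog.progTransforms_pad (by simp) _ _ (encode_eq _) encode_toQuadFormula
  · exact Prog.progTransforms_pad (by simp) _ _ (encodePair_eq _)
      fun x => encodePair_toQuadFormula x.1 x.2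
  · exact Prog.progTransforms_pad (by simp) _ _ (encodePair_eq _)
      fun x => encodePair_toQuadFormula_pad x.1 x.2

/-! ### The strings of the axioms -/

/-- The first index of the products `xᵢxⱼ`, `i ≤ j < n`, in their lexicographic order. -/
def rowStart (n : ℕ) : ℕ → ℕ
  | 0 => 0
  | i + 1 => rowStart n i + (n - i)

/-- The encoding of `ε₁xᵢ + ε₂xⱼ - xᵢxⱼ = ρ`, with `k₁, k₂, k₃, k₄` commas between the nonzero
coefficients. -/
def rowString (ε₁ ε₂ ρ : Bool) (k₁ k₂ k₃ k₄ : ℕ) : List Letter :=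
  List.replicate k₁ Letter.comma ++ ((bif ε₁ then [Letter.plus] else []) ++
    (List.replicate k₂ Letter.comma ++ ((bif ε₂ then [Letter.plus] else []) ++
    (List.replicate k₃ Letter.comma ++ (Letter.minus :: (List.replicate k₄ Letter.comma ++
    ((bif ρ then [Letter.plus] else []) ++ [Letter.endEquation])))))))

/-- The encoding of `ε₁xᵢ + ε₂xⱼ - xᵢxⱼ ∈ {0, 1}`. -/
def boolString (ε₁ ε₂ : Bool) (k₁ k₂ k₃ k₄ : ℕ) : List Letter :=
  rowString ε₁ ε₂ false k₁ k₂ k₃ k₄ ++ (rowString ε₁ ε₂ true k₁ k₂ k₃ k₄ ++ [Letter.endClause])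

/-- The encoding of the axioms about `xᵢxⱼ`. -/
def blockString (k₁ k₂ k₃ k₄ : ℕ) : List Letter :=
  boolString true true k₁ k₂ k₃ k₄ ++
    (boolString true false k₁ k₂ k₃ k₄ ++ boolString false true k₁ k₂ k₃ k₄)

/-- The encoding of the first `k` blocks of axioms about the products of `xᵢ`. -/
def rowBlocks (n i k : ℕ) : List Letter :=
  (List.range k).flatMap fun j =>
    blockString i j (n - i + rowStart n i) (tri n - rowStart n i - j)

/-- The encoding of the axioms about the products of the first `k` variables. -/
def axiomString (n k : ℕ) : List Letter :=
  (List.range k).flatMap fun i => rowBlocks n i (n - i)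

namespace Prog

variable {A : Type}

/-! ### Programs for strings with counters -/

/-- Write a letter, or as many commas as a stack contains. -/
def writeItem (f : Letter → A) : Letter ⊕ Stk → Prog Stk A
  | .inl l => .push .out (f l)
  | .inr x => emit x .out .tmp (f .comma)

/-- Write letters and commas. -/
def writeItems (f : Letter → A) : List (Letter ⊕ Stk) → Prog Stk A
  | [] => .pop .tmp
  | i :: l => .seq (writeItem f i) (writeItems f l)

/-- The string that is written. -/
def itemsString (S : Stk → List A) (l : List (Letter ⊕ Stk)) : List Letter :=
  l.flatMap (Sum.elim (fun a => [a]) fun x => List.replicate (S x).length Letter.comma)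

theorem runsIn_writeItems (f : Letter → A) (B : ℕ) (l : List (Letter ⊕ Stk)) :
    ∀ S : Stk → List A, S .tmp = [] →
      (∀ x, .inr x ∈ l → x ≠ .out ∧ x ≠ .tmp ∧ (S x).length ≤ B) →
      RunsIn (writeItems f l) S
        (update S .out (((itemsString S l).map f).reverse ++ S .out))
        (l.length * (5 * B + 2) + 1) := by
  induction l with
  | nil =>
    intro S hS _
    refine (runsIn_pop Stk.tmp S).congr ?_ (by simp)
    rw [show (S .tmp).tail = S .tmp by simp [hS], update_eq_self]
    simp [itemsString]
  | cons i l ih =>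
    intro S hS hl
    have h₁ : RunsIn (writeItem f i) S (update S .out
        (((itemsString S [i]).map f).reverse ++ S .out)) (5 * B + 2) := by
      rcases i with a | x
      · exact (runsIn_push Stk.out (f a) S).mono (by omega)
      · obtain ⟨hx, hx', hB⟩ := hl x (by simp)
        refine (runsIn_emit hx hx' (by simp) (f .comma) S rfl hS).congr ?_ (by omega)
        simp [itemsString]
    have h₂ := ih (update S .out (((itemsString S [i]).map f).reverse ++ S .out))
      (by rw [update_of_ne (by simp), hS])
      fun x hx => by
        have h := hl x (by simp [hx])
        rw [update_of_ne h.1]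
        exact h
    have e : itemsString (update S .out (((itemsString S [i]).map f).reverse ++ S .out)) l =
        itemsString S l := by
      unfold itemsString
      refine List.flatMap_congr fun j hj => ?_
      rcases j with a | x
      · rfl
      · simp [update_of_ne (hl x (by simp [hj])).1]
    rw [e] at h₂
    refine (h₁.seq h₂).congr ?_ ?_
    · simp [itemsString]
    · rw [List.length_cons]; ring_nf; rfl

/-- The items of an axiom equation. -/
def rowItems (ε₁ ε₂ ρ : Bool) : List (Letter ⊕ Stk) :=
  .inr .c₁ :: ((bif ε₁ then [.inl .plus] else []) ++ .inr .c₂ ::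
    ((bif ε₂ then [.inl .plus] else []) ++ .inr .c₃ :: .inl .minus :: .inr .t ::
    ((bif ρ then [.inl .plus] else []) ++ [.inl .endEquation])))

/-- The items of an axiom. -/
def boolItems (ε₁ ε₂ : Bool) : List (Letter ⊕ Stk) :=
  rowItems ε₁ ε₂ false ++ (rowItems ε₁ ε₂ true ++ [.inl .endClause])

/-- The items of the axioms about a product. -/
def blockItems : List (Letter ⊕ Stk) :=
  boolItems true true ++ (boolItems true false ++ boolItems false true)

theorem itemsString_append (S : Stk → List A) (l l' : List (Letter ⊕ Stk)) :
    itemsString S (l ++ l') = itemsString S l ++ itemsString S l' := List.flatMap_append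

theorem itemsString_rowItems (S : Stk → List A) (ε₁ ε₂ ρ : Bool) :
    itemsString S (rowItems ε₁ ε₂ ρ) = rowString ε₁ ε₂ ρ (S .c₁).length (S .c₂).length
      (S .c₃).length (S .t).length := by
  cases ε₁ <;> cases ε₂ <;> cases ρ <;> simp [itemsString, rowItems, rowString]

theorem itemsString_boolItems (S : Stk → List A) (ε₁ ε₂ : Bool) :
    itemsString S (boolItems ε₁ ε₂) = boolString ε₁ ε₂ (S .c₁).length (S .c₂).length
      (S .c₃).length (S .t).length := by
  simp only [boolItems, itemsString_append, itemsString_rowItems, boolString]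
  rfl

theorem itemsString_blockItems (S : Stk → List A) :
    itemsString S blockItems = blockString (S .c₁).length (S .c₂).length
      (S .c₃).length (S .t).length := by
  simp only [blockItems, itemsString_append, itemsString_boolItems, blockString]

/-! ### The program for the axioms -/

/-- The stacks while the axioms are written. -/
def axState (mark : A) (inp r : List A) (t c₁ c₂ c₃ : ℕ) (q out : List A) : Stk → List A :=
  stk inp [] r (List.replicate t mark) (List.replicate c₁ mark) (List.replicate c₂ mark)
    (List.replicate c₃ mark) q [] out

/-- The constant is the number of items of a block: 18 for the axiom with two variables, 16 for each
of the other two. -/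
theorem runsIn_blockItems (f : Letter → A) {mark : A} {B : ℕ} (inp r : List A)
    {t c₁ c₂ c₃ : ℕ} (q out : List A) (ht : t ≤ B) (h₁ : c₁ ≤ B) (h₂ : c₂ ≤ B) (h₃ : c₃ ≤ B) :
    RunsIn (writeItems f blockItems) (axState mark inp r t c₁ c₂ c₃ q out)
      (axState mark inp r t c₁ c₂ c₃ q (((blockString c₁ c₂ c₃ t).map f).reverse ++ out))
      (50 * (5 * B + 2) + 1) := by
  refine (runsIn_writeItems f B blockItems _ rfl ?_).congr ?_ ?_
  · intro x hx
    have hx' : x = .c₁ ∨ x = .c₂ ∨ x = .c₃ ∨ x = .t := by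
      simp [blockItems, boolItems, rowItems] at hx
      tauto
    rcases hx' with rfl | rfl | rfl | rfl <;> simpa [axState, stk]
  · rw [itemsString_blockItems]
    simp [axState, stk]
  · simp [blockItems, boolItems, rowItems]

theorem rowBlocks_succ (n i k : ℕ) : rowBlocks n i (k + 1) = rowBlocks n i k ++
    blockString i k (n - i + rowStart n i) (tri n - rowStart n i - k) := by
  simp [rowBlocks, List.range_succ]

theorem axiomString_succ (n k : ℕ) :
    axiomString n (k + 1) = axiomString n k ++ rowBlocks n k (n - k) := by
  simp [axiomString, List.range_succ]

theorem rowStart_le (n i : ℕ) : rowStart n i ≤ i * n := by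
  induction i with
  | zero => simp [rowStart]
  | succ i ih =>
    have := Nat.sub_le n i
    rw [rowStart, Nat.succ_mul]
    omega

/-- Write the axioms about the products of one variable. -/
def rowProg (f : Letter → A) : Prog Stk A :=
  forEach .q fun _ => .seq (writeItems f blockItems) (.seq (.push .c₂ (f .plus)) (.pop .t))

/-- Passing from `xᵢxⱼ` to `xᵢxⱼ₊₁` moves one comma from after the product to between the two
variables: `c₂` gains a letter, `t` loses one, and `c₁`, `c₃` do not change. After the `n - i`
products of the row, `t` is ready for the next row. -/
theorem runsIn_rowProg (f : Letter → A) {n i B : ℕ} (hi : i ≤ n) (hB : n + n * n ≤ B)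
    (inp r out : List A) :
    RunsIn (rowProg f)
      (axState (f .plus) inp r (tri n - rowStart n i) i 0 (n - i + rowStart n i)
        (List.replicate (n - i) (f .plus)) out)
      (axState (f .plus) inp r (tri n - rowStart n (i + 1)) i (n - i) (n - i + rowStart n i) []
        (((rowBlocks n i (n - i)).map f).reverse ++ out))
      (n * (50 * (5 * B + 2) + 4) + 1) := by
  have hs := rowStart_le n i
  have hin : i * n ≤ n * n := Nat.mul_le_mul_right n hi
  have ht := tri_le n
  let T : List A → Stk → List A := fun l => axState (f .plus) inp r
    (tri n - rowStart n i - (n - i - l.length)) i (n - i - l.length) (n - i + rowStart n i) l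
    (((rowBlocks n i (n - i - l.length)).map f).reverse ++ out)
  have h := runsIn_forEach (j := Stk.q) (b := fun _ => .seq (writeItems f blockItems)
    (.seq (.push .c₂ (f .plus)) (.pop .t))) (t := 50 * (5 * B + 2) + 3) T
    (List.replicate (n - i) (f .plus)) (fun _ => rfl) fun b l hl => ?_
  · have e : T (List.replicate (n - i) (f .plus)) = axState (f .plus) inp r
        (tri n - rowStart n i) i 0 (n - i + rowStart n i)
        (List.replicate (n - i) (f .plus)) out := by simp [T, rowBlocks]
    rw [e] at h
    refine h.congr ?_ ?_
    · simp [T, rowStart, Nat.sub_sub]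
    · rw [List.length_replicate]
      gcongr
      omega
  · have hlen : l.length + 1 ≤ n - i := by simpa using hl.length_le
    obtain ⟨k, hk⟩ := Nat.exists_eq_add_of_le hlen
    have e₁ : n - i - (l.length + 1) = k := by omega
    have e₂ : n - i - l.length = k + 1 := by omega
    have h₁ := runsIn_blockItems f (mark := f .plus) (B := B) inp r
      (t := tri n - rowStart n i - k) (c₁ := i) (c₂ := k) (c₃ := n - i + rowStart n i) l
      (((rowBlocks n i k).map f).reverse ++ out)
      (by omega) (by omega) (by omega) (by omega)
    refine (RunsIn.seq (S' := axState (f .plus) inp r (tri n - rowStart n i - k) i k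
      (n - i + rowStart n i) l (((rowBlocks n i (k + 1)).map f).reverse ++ out))
      (t := 50 * (5 * B + 2) + 1) ?_
      ((runsIn_push Stk.c₂ (f .plus) _).seq (runsIn_pop Stk.t _))).congr ?_ ?_
    · simp only [T, List.length_cons, e₁, axState, update_stk_q, rowBlocks_succ] at h₁ ⊢
      exact h₁.congr (by simp) le_rfl
    · simp only [T, e₂, axState, update_stk_c₂, update_stk_t, stk, List.tail_replicate,
        List.replicate_succ, Nat.sub_add_eq]
    · omega

/-- Write the axioms about the products of all variables. -/
def rowsProg (f : Letter → A) : Prog Stk A :=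
  forEach .r fun _ => .seq (emit .r .q .tmp (f .plus)) (.seq (.push .q (f .plus))
    (.seq (rowProg f) (.seq (clear .c₂ .tmp) (.seq (.push .c₁ (f .plus))
      (emit .r .c₃ .tmp (f .plus))))))

theorem runsIn_rowsProg (f : Letter → A) {n B : ℕ} (hB : n + n * n ≤ B) (inp out : List A) :
    RunsIn (rowsProg f)
      (axState (f .plus) inp (List.replicate n (f .plus)) (tri n) 0 0 n [] out)
      (axState (f .plus) inp [] (tri n - rowStart n n) n 0 (rowStart n n) []
        (((axiomString n n).map f).reverse ++ out))
      (n * (n * (50 * (5 * B + 2) + 4) + 1 + (12 * n + 8)) + 1) := by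
  let T : List A → Stk → List A := fun l => axState (f .plus) inp l
    (tri n - rowStart n (n - l.length)) (n - l.length) 0
    (n - (n - l.length) + rowStart n (n - l.length)) []
    (((axiomString n (n - l.length)).map f).reverse ++ out)
  have h := runsIn_forEach (j := Stk.r) (b := fun _ => .seq (emit .r .q .tmp (f .plus))
    (.seq (.push .q (f .plus)) (.seq (rowProg f) (.seq (clear .c₂ .tmp)
    (.seq (.push .c₁ (f .plus)) (emit .r .c₃ .tmp (f .plus)))))))
    (t := n * (50 * (5 * B + 2) + 4) + 1 + (12 * n + 7)) T
    (List.replicate n (f .plus)) (fun _ => rfl) fun b l hl => ?_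
  · have e : T (List.replicate n (f .plus)) = axState (f .plus) inp (List.replicate n (f .plus))
        (tri n) 0 0 n [] out := by simp [T, rowStart, axiomString]
    rw [e] at h
    exact h.congr (by simp [T])
      (by rw [List.length_replicate, Nat.add_assoc _ (12 * n + 7)])
  · have hlen : l.length + 1 ≤ n := by simpa using hl.length_le
    obtain ⟨i, hi⟩ := Nat.exists_eq_add_of_le hlen
    have e₁ : n - (l.length + 1) = i := by omega
    have e₂ : n - l.length = i + 1 := by omega
    have e₃ : n - i = l.length + 1 := by omega
    -- The loop has already popped a letter of `r`, so `n - i - 1` remain. The extra push on `q`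
    -- completes the length `n - i` of the row.
    have h₁ := runsIn_emit (x := Stk.r) (y := .q) (z := .tmp) (m := l.length) (by simp) (by simp)
      (by simp) (f .plus) (axState (f .plus) inp l (tri n - rowStart n i) i 0
        (n - i + rowStart n i) [] (((axiomString n i).map f).reverse ++ out)) rfl rfl
    have h₂ := runsIn_push Stk.q (f .plus) (axState (f .plus) inp l (tri n - rowStart n i) i 0
        (n - i + rowStart n i) (List.replicate l.length (f .plus))
        (((axiomString n i).map f).reverse ++ out))
    have h₃ := runsIn_rowProg f (n := n) (i := i) (by omega) hB inp l
      (((axiomString n i).map f).reverse ++ out)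
    have h₄ := runsIn_clear (x := Stk.c₂) (z := .tmp) (by simp)
      (List.replicate (n - i) (f .plus)) (axState (f .plus) inp l (tri n - rowStart n (i + 1)) i
        (n - i) (n - i + rowStart n i) []
        (((rowBlocks n i (n - i)).map f).reverse ++ (((axiomString n i).map f).reverse ++ out)))
      rfl rfl
    have h₅ := runsIn_push Stk.c₁ (f .plus) (axState (f .plus) inp l (tri n - rowStart n (i + 1)) i
        0 (n - i + rowStart n i) []
        (((rowBlocks n i (n - i)).map f).reverse ++ (((axiomString n i).map f).reverse ++ out)))
    have h₆ := runsIn_emit (x := Stk.r) (y := .c₃) (z := .tmp) (m := l.length) (by simp) (by simp)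
      (by simp) (f .plus) (axState (f .plus) inp l (tri n - rowStart n (i + 1)) (i + 1)
        0 (n - i + rowStart n i) []
        (((rowBlocks n i (n - i)).map f).reverse ++ (((axiomString n i).map f).reverse ++ out)))
      rfl rfl
    simp only [axState, stk, update_stk_q, update_stk_c₁, update_stk_c₂, update_stk_c₃,
      ← List.replicate_succ, List.append_nil, List.replicate_append_replicate,
      List.replicate_zero, List.length_replicate, e₃] at h₁ h₂ h₃ h₄ h₅ h₆
    simp only [T, axState, update_stk_r, List.length_cons, e₁, e₂, e₃]
    refine (h₁.seq (h₂.seq (h₃.seq (h₄.seq (h₅.seq h₆))))).congr ?_ ?_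
    -- From row `i` to row `i + 1`, the counter `c₃` grows by `n - i - 1`, which is exactly what
    -- remains on `r`.
    · have e₄ : n - (i + 1) + rowStart n (i + 1) = l.length + (l.length + 1 + rowStart n i) := by
        rw [rowStart]; omega
      rw [e₄, axiomString_succ, e₃]
      simp
    · omega

/-- The program that replaces the number of variables and inserts the axioms. -/
def axProg [DecidableEq A] (f : Letter → A) : Prog Stk A :=
  .seq (header (f .plus)) (.seq (triangle (f .plus)) (.seq (emit .r .out .tmp (f .plus))
    (.seq (emit .t .out .tmp (f .plus)) (.seq (.push .out (f .endClause))
    (.seq (emit .r .c₃ .tmp (f .plus)) (.seq (rowsProg f) (.seq (clear .t .tmp)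
    (.seq (clear .c₁ .tmp) (.seq (clear .c₃ .tmp) (move .inp .out))))))))))

/-- Only the number of variables changes and the axioms are inserted. The rest of the input is
copied verbatim, because an equation keeps its string when its monomials are renamed as variables.
-/
theorem runsIn_axProg [DecidableEq A] {f : Letter → A} (hf : f .endClause ≠ f .plus) (n : ℕ)
    (rest : List A) {N : ℕ} (hN : (List.replicate n (f .plus) ++ f .endClause :: rest).length = N) :
    RunsIn (axProg f) (single .inp (List.replicate n (f .plus) ++ f .endClause :: rest))
      (single .out (List.replicate (n + tri n) (f .plus) ++ f .endClause ::
        ((axiomString n n).map f ++ rest)).reverse)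
      (2 * N + 1 + (N * (5 * N + 4) + 1 + (5 * N + 2 + (5 * (N * N) + 2 + (1 + (5 * N + 2 +
        (N * (N * (50 * (5 * (N + N * N) + 2) + 4) + 1 + (12 * N + 8)) + 1 + (2 * (N * N) + 1 +
        (2 * N + 1 + (2 * (N * N) + 1 + (2 * N + 1))))))))))) := by
  have hn : n ≤ N := by simp [← hN]
  have hrest : rest.length ≤ N := by simp [← hN]; omega
  have htri : tri n ≤ N * N := (tri_le n).trans (Nat.mul_le_mul hn hn)
  have hrow : rowStart n n ≤ N * N := (rowStart_le n n).trans (Nat.mul_le_mul hn hn)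
  have h₁ := runsIn_header hf rest n
  have h₂ := runsIn_triangle (f .plus) n rest
  have h₃ := runsIn_emit (x := Stk.r) (y := .out) (z := .tmp) (m := n) (by simp) (by simp) (by simp)
    (f .plus) (axState (f .plus) rest (List.replicate n (f .plus)) (tri n) 0 0 0 [] [])
    (by simp [axState, stk]) rfl
  have h₄ := runsIn_emit (x := Stk.t) (y := .out) (z := .tmp) (m := tri n) (by simp) (by simp)
    (by simp) (f .plus) (axState (f .plus) rest (List.replicate n (f .plus)) (tri n) 0 0 0 []
      (List.replicate n (f .plus))) (by simp [axState, stk]) rfl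
  have h₅ := runsIn_push Stk.out (f .endClause) (axState (f .plus) rest
    (List.replicate n (f .plus)) (tri n) 0 0 0 [] (List.replicate (tri n + n) (f .plus)))
  have h₆ := runsIn_emit (x := Stk.r) (y := .c₃) (z := .tmp) (m := n) (by simp) (by simp) (by simp)
    (f .plus) (axState (f .plus) rest (List.replicate n (f .plus)) (tri n) 0 0 0 []
      (f .endClause :: List.replicate (tri n + n) (f .plus))) (by simp [axState, stk]) rfl
  have h₇ := runsIn_rowsProg f (n := n) le_rfl rest
    (f .endClause :: List.replicate (tri n + n) (f .plus))
  set out := ((axiomString n n).map f).reverse ++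
    f .endClause :: List.replicate (tri n + n) (f .plus) with hout
  have h₈ := runsIn_clear (x := Stk.t) (z := .tmp) (by simp) _ (axState (f .plus) rest []
    (tri n - rowStart n n) n 0 (rowStart n n) [] out) rfl rfl
  have h₉ := runsIn_clear (x := Stk.c₁) (z := .tmp) (by simp) _ (axState (f .plus) rest []
    0 n 0 (rowStart n n) [] out) rfl rfl
  have h₁₀ := runsIn_clear (x := Stk.c₃) (z := .tmp) (by simp) _ (axState (f .plus) rest []
    0 0 0 (rowStart n n) [] out) rfl rfl
  have h₁₁ := runsIn_move (x := Stk.inp) (y := .out) (by simp) _ (axState (f .plus) rest []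
    0 0 0 0 [] out) rfl
  simp only [axState, stk, update_stk_out, update_stk_c₁, update_stk_c₃, update_stk_t,
    update_stk_inp, List.append_nil, List.replicate_append_replicate,
    List.replicate_zero, List.length_replicate] at h₃ h₄ h₅ h₆ h₇ h₈ h₉ h₁₀ h₁₁
  refine (h₁.seq (h₂.seq (h₃.seq (h₄.seq (h₅.seq (h₆.seq (h₇.seq (h₈.seq (h₉.seq
    (h₁₀.seq h₁₁)))))))))).congr ?_ ?_
  · simp [single_out, hout, Nat.add_comm n]
  · have : tri n - rowStart n n ≤ N * N := (Nat.sub_le _ _).trans htri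
    gcongr

theorem progTransforms_ax [DecidableEq A] {α : Type} {f : Letter → A}
    (hf : f .endClause ≠ f .plus) {ea eb : α → List A} (n : α → ℕ) (rest : α → List A)
    (hea : ∀ x, ea x = List.replicate (n x) (f .plus) ++ f .endClause :: rest x)
    (heb : ∀ x, eb x = List.replicate (n x + tri (n x)) (f .plus) ++ f .endClause ::
      ((axiomString (n x) (n x)).map f ++ rest x)) :
    ProgTransforms ea eb := by
  refine ⟨Stk, inferInstance, inferInstance, axProg f, .inp, .out,
    2 * .X + 1 + (.X * (5 * .X + 4) + 1 + (5 * .X + 2 + (5 * (.X * .X) + 2 + (1 + (5 * .X + 2 +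
        (.X * (.X * (50 * (5 * (.X + .X * .X) + 2) + 4) + 1 + (12 * .X + 8)) + 1 +
        (2 * (.X * .X) + 1 + (2 * .X + 1 + (2 * (.X * .X) + 1 + (2 * .X + 1)))))))))),
    fun x => ?_⟩
  rw [hea, heb]
  refine (runsIn_axProg hf (n x) (rest x) rfl).mono (le_of_eq ?_)
  simp

end Prog

/-! ### The axioms of R(quad) as quadratic disjunctions -/

/-- The encoding of a list of coefficients. -/
def encodeCoeffs {M : Type} (c : M → ℤ) (l : List M) : List Letter :=
  l.flatMap fun m => encodeInt (c m) ++ [Letter.comma]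

theorem encodeCoeffs_append {M : Type} (c : M → ℤ) (l l' : List M) :
    encodeCoeffs c (l ++ l') = encodeCoeffs c l ++ encodeCoeffs c l' := List.flatMap_append

theorem encodeCoeffs_map {M N : Type} (c : N → ℤ) (g : M → N) (l : List M) :
    encodeCoeffs c (l.map g) = encodeCoeffs (fun m => c (g m)) l := List.flatMap_map ..

theorem encodeCoeffs_of_zero {M : Type} {c : M → ℤ} {l : List M} (h : ∀ m ∈ l, c m = 0) :
    encodeCoeffs c l = List.replicate l.length Letter.comma := by
  induction l with
  | nil => rfl
  | cons m l ih =>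
    rw [List.forall_mem_cons] at h
    rw [encodeCoeffs, List.flatMap_cons, ← encodeCoeffs, ih h.2, h.1]
    rfl

/-- At most one coefficient is nonzero. The `m - a` commas after it include the one that closes it.
-/
theorem encodeCoeffs_range' {c : ℕ → ℤ} {s m a : ℕ} (ha : a < m)
    (h : ∀ k, s ≤ k → k < s + m → k ≠ s + a → c k = 0) :
    encodeCoeffs c (List.range' s m) = List.replicate a Letter.comma ++
      (encodeInt (c (s + a)) ++ List.replicate (m - a) Letter.comma) := by
  obtain ⟨r, rfl⟩ := Nat.exists_eq_add_of_lt ha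
  have e : List.range' s (a + r + 1) =
      List.range' s a ++ ([s + a] ++ List.range' (s + a + 1) r) := by
    rw [List.singleton_append, ← List.range'_succ (step := 1), List.range'_append_1, Nat.add_assoc]
  have h₁ : ∀ k ∈ List.range' s a, c k = 0 := fun k hk => by
    rw [List.mem_range'_1] at hk
    exact h k (by omega) (by omega) (by omega)
  have h₂ : ∀ k ∈ List.range' (s + a + 1) r, c k = 0 := fun k hk => by
    rw [List.mem_range'_1] at hk
    exact h k (by omega) (by omega) (by omega)
  rw [e, encodeCoeffs_append, encodeCoeffs_append, encodeCoeffs_of_zero h₁,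
    encodeCoeffs_of_zero h₂, show a + r + 1 - a = r + 1 by omega, List.replicate_succ]
  simp [encodeCoeffs]

/-- The coefficients of the variables in `ε₁xᵢ + ε₂xⱼ - xᵢxⱼ`. -/
def linCoeff (ε₁ ε₂ : Bool) (i j k : ℕ) : ℤ :=
  (if ε₁ = true ∧ k = i then 1 else 0) + (if ε₂ = true ∧ k = j then 1 else 0)

/-- The coefficients of the products in `ε₁xᵢ + ε₂xⱼ - xᵢxⱼ`. -/
def quadCoeff (i j : ℕ) (z : Sym2 ℕ) : ℤ := if z = s(i, j) then -1 else 0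

theorem encodeCoeffs_linCoeff (ε₁ ε₂ : Bool) {i d n : ℕ} (h : i + d < n) :
    encodeCoeffs (linCoeff ε₁ ε₂ i (i + d)) (List.range n) =
      List.replicate i Letter.comma ++ ((bif ε₁ then [Letter.plus] else []) ++
        (List.replicate d Letter.comma ++ ((bif ε₂ then [Letter.plus] else []) ++
          List.replicate (n - i - d) Letter.comma))) := by
  rw [List.range_eq_range']
  rcases d with _ | d
  -- For `i = j` with both signs present the coefficient is 2. Its unary code is two plus signs with
  -- no comma in between, in agreement with the general formula at `d = 0`.
  · rw [encodeCoeffs_range' (a := i) (by omega)]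
    · cases ε₁ <;> cases ε₂ <;> simp [linCoeff, encodeInt]
    · intro k _ _ hk
      have : k ≠ i := by omega
      simp [linCoeff, this]
  -- Cutting the range just after `i` leaves at most one nonzero coefficient in each half.
  · have e : List.range' 0 n = List.range' 0 (i + 1) ++ List.range' (i + 1) (n - (i + 1)) := by
      have := List.range'_append_1 (s := 0) (m := i + 1) (n := n - (i + 1))
      rw [Nat.zero_add, show i + 1 + (n - (i + 1)) = n by omega] at this
      exact this.symm
    rw [e, encodeCoeffs_append, encodeCoeffs_range' (a := i) (by omega),
      encodeCoeffs_range' (a := d) (by omega)]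
    · have h₁ : linCoeff ε₁ ε₂ i (i + (d + 1)) (0 + i) = bif ε₁ then 1 else 0 := by
        cases ε₁ <;> simp [linCoeff]
      have h₂ : linCoeff ε₁ ε₂ i (i + (d + 1)) (i + 1 + d) = bif ε₂ then 1 else 0 := by
        have e₂ : i + 1 + d = i + (d + 1) := by omega
        cases ε₂ <;> simp [linCoeff, e₂]
      rw [h₁, h₂, show n - (i + 1) - d = n - i - (d + 1) by omega, Nat.add_sub_cancel_left,
        List.replicate_succ (n := d)]
      cases ε₁ <;> cases ε₂ <;> simp [encodeInt, -List.replicate_append_replicate]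
    · intro k _ _ hk
      have e₁ : k ≠ i := by omega
      have e₂ : k ≠ i + (d + 1) := by omega
      simp [linCoeff, e₁, e₂]
    · intro k _ _ hk
      have e₁ : k ≠ i := by omega
      have e₂ : k ≠ i + (d + 1) := by omega
      simp [linCoeff, e₁, e₂]

theorem rowStart_succ_succ (n i : ℕ) : rowStart (n + 1) (i + 1) = n + 1 + rowStart n i := by
  induction i with
  | zero => simp [rowStart]
  | succ i ih =>
    rw [rowStart, ih, rowStart, Nat.add_sub_add_right]
    ring

theorem length_sym2_range' (s m : ℕ) : (List.range' s m).sym2.length = tri m := by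
  simp [List.length_sym2, tri]

/-- The unordered pairs from `s, s + 1, …` start with the row of all pairs containing `s`, followed
by the pairs from `s + 1` on. Removing that row lowers `i` and `n` by one and raises `s`, so the
induction needs `s` arbitrary. -/
theorem encodeCoeffs_quadCoeff {i d : ℕ} : ∀ {n : ℕ} (s : ℕ), i + d < n →
    encodeCoeffs (quadCoeff (s + i) (s + i + d)) (List.range' s n).sym2 =
      List.replicate (rowStart n i + d) Letter.comma ++
        Letter.minus :: List.replicate (tri n - rowStart n i - d) Letter.comma := by
  induction i with
  | zero =>
    intro n s h
    obtain ⟨n, rfl⟩ : ∃ m, n = m + 1 := ⟨n - 1, by omega⟩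
    have e : (List.range' s (n + 1)).sym2 = (List.range' s (n + 1)).map (fun k => s(s, k)) ++
      (List.range' (s + 1) n).sym2 := rfl
    rw [e, encodeCoeffs_append, encodeCoeffs_map, encodeCoeffs_range' (a := d) (by omega),
      encodeCoeffs_of_zero, length_sym2_range']
    · have h₁ : quadCoeff (s + 0) (s + 0 + d) s(s, s + d) = -1 := by simp [quadCoeff]
      rw [h₁, tri_succ, rowStart, show tri n + (n + 1) - 0 - d = n + 1 - d + tri n by omega,
        ← List.replicate_append_replicate]
      simp [encodeInt]
    · intro z hz
      refine if_neg ?_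
      rintro rfl
      have := List.left_mem_of_mk_mem_sym2 hz
      rw [List.mem_range'_1] at this
      omega
    · intro k _ _ hk
      refine if_neg fun hs => ?_
      rw [Sym2.eq_iff] at hs
      omega
  | succ i ih =>
    intro n s h
    obtain ⟨n, rfl⟩ : ∃ m, n = m + 1 := ⟨n - 1, by omega⟩
    have e : (List.range' s (n + 1)).sym2 = (List.range' s (n + 1)).map (fun k => s(s, k)) ++
      (List.range' (s + 1) n).sym2 := rfl
    rw [e, encodeCoeffs_append, encodeCoeffs_map, encodeCoeffs_of_zero,
      show s + (i + 1) = s + 1 + i by omega, ih (s + 1) (by omega), rowStart_succ_succ, tri_succ,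
      show tri n + (n + 1) - (n + 1 + rowStart n i) = tri n - rowStart n i by omega,
      List.length_range', ← List.append_assoc, List.replicate_append_replicate, Nat.add_assoc (n + 1)]
    intro k hk
    refine if_neg fun hs => ?_
    rw [Sym2.eq_iff] at hs
    omega

/-- The equation `ε₁xᵢ + ε₂xⱼ - xᵢxⱼ = ρ`. -/
def axEq (n : ℕ) (ε₁ ε₂ ρ : Bool) (i j : ℕ) : Equation (QuadMonomial n) :=
  ⟨Sum.elim (fun k => linCoeff ε₁ ε₂ i j k) (fun z => quadCoeff i j (z.map Fin.val)),
    bif ρ then 1 else 0⟩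

/-- The disjunction `ε₁xᵢ + ε₂xⱼ - xᵢxⱼ ∈ {0, 1}`. -/
def axClause (n : ℕ) (ε₁ ε₂ : Bool) (i j : ℕ) : Clause (QuadMonomial n) :=
  [axEq n ε₁ ε₂ false i j, axEq n ε₁ ε₂ true i j]

/-- The axioms about the products of variables. -/
def axClauses (n : ℕ) : List (Clause (QuadMonomial n)) :=
  (List.range n).flatMap fun i => (List.range (n - i)).flatMap fun d =>
    [axClause n true true i (i + d), axClause n true false i (i + d),
      axClause n false true i (i + d)]

/-- Between `xⱼ` and `xᵢxⱼ`, with `j = i + d`, there are `n - i - d` commas of variables and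
`rowStart n i + d` of products. The sum is independent of `d`, so this counter is constant along a
row. -/
theorem encodeEquation_axEq (ε₁ ε₂ ρ : Bool) {i d n : ℕ} (h : i + d < n) :
    encodeEquation (quadMonomials n) (axEq n ε₁ ε₂ ρ i (i + d)) =
      rowString ε₁ ε₂ ρ i d (n - i + rowStart n i) (tri n - rowStart n i - d) := by
  have h₁ : encodeCoeffs (axEq n ε₁ ε₂ ρ i (i + d)).coeff (quadMonomials n) =
      encodeCoeffs (linCoeff ε₁ ε₂ i (i + d)) (List.range n) ++
        encodeCoeffs (quadCoeff i (i + d)) (List.range' 0 n).sym2 := by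
    rw [← List.range_eq_range', ← List.map_coe_finRange_eq_range, List.sym2_map, encodeCoeffs_map,
      encodeCoeffs_map, quadMonomials, encodeCoeffs_append, encodeCoeffs_map, encodeCoeffs_map]
    rfl
  have h₂ := encodeCoeffs_quadCoeff 0 h
  rw [Nat.zero_add] at h₂
  rw [encodeEquation, ← encodeCoeffs, h₁, h₂, encodeCoeffs_linCoeff ε₁ ε₂ h,
    rowString, show n - i + rowStart n i = n - i - d + (rowStart n i + d) by omega]
  generalize rowStart n i + d = q
  rw [← List.replicate_append_replicate]
  cases ρ <;> simp [encodeInt, axEq, -List.replicate_append_replicate]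

theorem encodeClause_axClause (ε₁ ε₂ : Bool) {i d n : ℕ} (h : i + d < n) :
    encodeClause (quadMonomials n) (axClause n ε₁ ε₂ i (i + d)) =
      boolString ε₁ ε₂ i d (n - i + rowStart n i) (tri n - rowStart n i - d) := by
  simp [encodeClause, axClause, boolString, encodeEquation_axEq _ _ _ h]

theorem encodeLines_axClauses (n : ℕ) :
    encodeLines (quadMonomials n) (axClauses n) = axiomString n n := by
  unfold encodeLines axClauses axiomString rowBlocks
  rw [List.flatMap_assoc]
  refine List.flatMap_congr fun i _ => ?_
  rw [List.flatMap_assoc]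
  refine List.flatMap_congr fun d hd => ?_
  have h : i + d < n := by
    rw [List.mem_range] at hd
    omega
  simp [encodeClause_axClause _ _ h, blockString]

theorem axEq_eq {n : ℕ} (ε₁ ε₂ ρ : Bool) (i j : Fin n) :
    axEq n ε₁ ε₂ ρ i j = ⟨(bif ε₁ then quadVar i else 0) + (bif ε₂ then quadVar j else 0) -
      quadProd i j, bif ρ then 1 else 0⟩ := by
  ext m
  · rcases m with k | z
    · cases ε₁ <;> cases ε₂ <;>
        simp [axEq, linCoeff, quadVar, quadProd, Pi.single_apply, Fin.ext_iff]
    · have h : z.map Fin.val = s(i.val, j.val) ↔ z = s(i, j) := by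
        rw [← Sym2.map_mk, (Sym2.map.injective Fin.val_injective).eq_iff]
      cases ε₁ <;> cases ε₂ <;>
        simp [axEq, quadCoeff, quadVar, quadProd, Pi.single_apply, h, apply_ite Neg.neg]
  · rfl

theorem toSet_axClause {n : ℕ} (ε₁ ε₂ : Bool) (i j : Fin n) :
    Clause.toSet (axClause n ε₁ ε₂ i j) = boolEq ((bif ε₁ then quadVar i else 0) +
      (bif ε₂ then quadVar j else 0) - quadProd i j) := by
  ext L
  simp [Clause.toSet, axClause, axEq_eq, boolEq]

theorem mem_axClauses {n : ℕ} {C : Clause (QuadMonomial n)} :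
    C ∈ axClauses n ↔ ∃ (ε₁ ε₂ : Bool) (i j : Fin n), (ε₁ || ε₂) = true ∧ i ≤ j ∧
      C = axClause n ε₁ ε₂ i j := by
  simp only [axClauses, List.mem_flatMap, List.mem_range, List.mem_cons, List.not_mem_nil, or_false]
  constructor
  · rintro ⟨i, hi, d, hd, h⟩
    have hij : (⟨i, hi⟩ : Fin n) ≤ ⟨i + d, by omega⟩ := by simp
    rcases h with rfl | rfl | rfl
    · exact ⟨true, true, ⟨i, hi⟩, ⟨i + d, by omega⟩, rfl, hij, rfl⟩
    · exact ⟨true, false, ⟨i, hi⟩, ⟨i + d, by omega⟩, rfl, hij, rfl⟩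
    · exact ⟨false, true, ⟨i, hi⟩, ⟨i + d, by omega⟩, rfl, hij, rfl⟩
  · rintro ⟨ε₁, ε₂, i, j, hε, hij, rfl⟩
    have hij : i.val ≤ j.val := hij
    refine ⟨i, i.2, j - i, by omega, ?_⟩
    rw [Nat.add_sub_cancel' hij]
    cases ε₁ <;> cases ε₂ <;> simp_all

/-- Only products with `i ≤ j` are listed. For `j ≤ i`, the axiom `xᵢ - xᵢxⱼ` is the third clause of
the pair `(j, i)`, which explains three clauses per unordered pair. -/
theorem quadAxioms_cases {n : ℕ} {D : Set (Equation (QuadMonomial n))} (hD : D ∈ quadAxioms n) :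
    (∃ i, D = boolEq (quadVar i)) ∨ ∃ C ∈ axClauses n, D = Clause.toSet C := by
  have hcomm (i j : Fin n) : quadProd i j = quadProd j i := by
    rw [quadProd, quadProd, Sym2.eq_swap]
  obtain ⟨i, j, rfl | rfl | rfl⟩ := hD
  · exact .inl ⟨i, rfl⟩
  · right
    rcases le_total i j with h | h
    · exact ⟨_, mem_axClauses.2 ⟨true, true, i, j, rfl, h, rfl⟩, by simp [toSet_axClause]⟩
    · refine ⟨_, mem_axClauses.2 ⟨true, true, j, i, rfl, h, rfl⟩, ?_⟩
      simp [toSet_axClause, hcomm i j, add_comm]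
  · right
    rcases le_total i j with h | h
    · exact ⟨_, mem_axClauses.2 ⟨true, false, i, j, rfl, h, rfl⟩, by simp [toSet_axClause]⟩
    · refine ⟨_, mem_axClauses.2 ⟨false, true, j, i, rfl, h, rfl⟩, ?_⟩
      simp [toSet_axClause, hcomm i j]

/-! ### Quadratic formulas as linear formulas -/

/-- The number of the monomials of degree at most two. -/
def numMonomials (n : ℕ) : ℕ := (quadMonomials n).length

theorem numMonomials_eq (n : ℕ) : numMonomials n = n + tri n := by
  simp [numMonomials, quadMonomials, length_sym2_finRange]

theorem nodup_quadMonomials (n : ℕ) : (quadMonomials n).Nodup := by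
  refine List.Nodup.append ((List.nodup_finRange n).map Sum.inl_injective)
    ((List.nodup_finRange n).sym2.map Sum.inr_injective) ?_
  simp [List.disjoint_left]

theorem mem_quadMonomials {n : ℕ} (m : QuadMonomial n) : m ∈ quadMonomials n := by
  rcases m with k | z
  · simp [quadMonomials]
  · induction z with
    | _ i j => simp [quadMonomials, List.mk_mem_sym2_iff]

/-- The monomials of degree at most two, numbered. -/
def monomialEquiv (n : ℕ) : Fin (numMonomials n) ≃ QuadMonomial n :=
  (nodup_quadMonomials n).getEquivOfForallMemList _ mem_quadMonomials

theorem map_monomialEquiv (n : ℕ) :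
    (List.finRange (numMonomials n)).map (monomialEquiv n) = quadMonomials n :=
  List.map_get_finRange _

/-- A quadratic equation as a linear equation in the monomials. -/
def toLinEq {n : ℕ} (L : Equation (QuadMonomial n)) : Equation (LinMonomial (numMonomials n)) :=
  ⟨fun k => L.coeff (monomialEquiv n k), L.rhs⟩

/-- The numbering `monomialEquiv` follows the order in which coefficients are written, so renaming
monomials as variables does not affect the string. -/
theorem encodeEquation_toLinEq {n : ℕ} (L : Equation (QuadMonomial n)) :
    encodeEquation (linMonomials (numMonomials n)) (toLinEq L) =
      encodeEquation (quadMonomials n) L := by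
  rw [encodeEquation, encodeEquation, ← encodeCoeffs, ← encodeCoeffs, ← map_monomialEquiv,
    encodeCoeffs_map]
  rfl

theorem encodeLines_toLinEq {n : ℕ} (π : List (Clause (QuadMonomial n))) :
    encodeLines (linMonomials (numMonomials n)) (π.map (List.map toLinEq)) =
      encodeLines (quadMonomials n) π := by
  unfold encodeLines
  rw [List.flatMap_map]
  refine List.flatMap_congr fun D _ => ?_
  simp only [encodeClause, List.flatMap_map, encodeEquation_toLinEq]

theorem toLinEq_holds {n : ℕ} (b : Fin (numMonomials n) → Bool) (L : Equation (QuadMonomial n)) :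
    (toLinEq L).Holds (LinMonomial.val b) ↔
      L.Holds fun m => LinMonomial.val b ((monomialEquiv n).symm m) := by
  unfold Equation.Holds toLinEq
  rw [← Equiv.sum_comp (monomialEquiv n)]
  simp only [Equiv.symm_apply_apply]

/-- A quadratic formula as a linear formula in the monomials, with additional axioms. -/
def toLinFormula (τ : QuadFormula) : LinFormula :=
  ⟨numMonomials τ.n, (axClauses τ.n ++ τ.clauses).map (List.map toLinEq)⟩

theorem toLinFormula_forall (τ : QuadFormula) (b : Fin (numMonomials τ.n) → Bool) :
    (∀ D ∈ (toLinFormula τ).clauses, ∃ L ∈ D, L.Holds (LinMonomial.val b)) ↔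
      ∀ D ∈ axClauses τ.n ++ τ.clauses, ∃ L ∈ D,
        L.Holds fun m => LinMonomial.val b ((monomialEquiv τ.n).symm m) := by
  refine List.forall_mem_map.trans (forall₂_congr fun D _ => ?_)
  constructor
  · rintro ⟨L, hL, h⟩
    obtain ⟨L', hL', rfl⟩ := List.mem_map.1 hL
    exact ⟨L', hL', (toLinEq_holds b L').1 h⟩
  · rintro ⟨L, hL, h⟩
    exact ⟨toLinEq L, List.mem_map_of_mem hL, (toLinEq_holds b L).2 h⟩

theorem axClause_holds {n : ℕ} (v : QuadMonomial n → ℤ) (ε₁ ε₂ : Bool) (i j : Fin n) :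
    (∃ L ∈ axClause n ε₁ ε₂ i j, L.Holds v) ↔
      (bif ε₁ then v (.inl i) else 0) + (bif ε₂ then v (.inl j) else 0) - v (.inr s(i, j)) = 0 ∨
      (bif ε₁ then v (.inl i) else 0) + (bif ε₂ then v (.inl j) else 0) - v (.inr s(i, j)) = 1 := by
  have h (ρ : Bool) : (axEq n ε₁ ε₂ ρ i j).Holds v ↔
      (bif ε₁ then v (.inl i) else 0) + (bif ε₂ then v (.inl j) else 0) - v (.inr s(i, j)) =
        bif ρ then 1 else 0 := by
    have hv (m₀ : QuadMonomial n) :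
        ∑ m, (Pi.single m₀ 1 : QuadMonomial n → ℤ) m * v m = v m₀ := by
      rw [Finset.sum_eq_single m₀ (fun m _ hm => by simp [hm]) (by simp)]
      simp
    rw [axEq_eq, Equation.Holds]
    simp only [Pi.add_apply, Pi.sub_apply, add_mul, sub_mul, Finset.sum_add_distrib,
      Finset.sum_sub_distrib, quadProd, hv]
    cases ε₁ <;> cases ε₂ <;> simp [quadVar, hv]
  simp [axClause, h]

/-- For Boolean `x, y, z`, the conditions `x - z ≥ 0` and `y - z ≥ 0` exclude `z = 1` unless `x = y
= 1`, and `x + y - z ≤ 1` excludes `z = 0` in that case. An assignment satisfying the added clauses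
is thus the evaluation of monomials at an assignment of the original variables. -/
theorem toLinFormula_satisfiable (τ : QuadFormula) :
    (toLinFormula τ).Satisfiable ↔ τ.Satisfiable := by
  constructor
  · rintro ⟨(b : Fin (numMonomials τ.n) → Bool), hb⟩
    replace hb := (toLinFormula_forall τ b).1 hb
    rw [List.forall_mem_append] at hb
    refine ⟨fun i => b ((monomialEquiv τ.n).symm (.inl i)), ?_⟩
    have hv : (fun m => LinMonomial.val b ((monomialEquiv τ.n).symm m)) =
        QuadMonomial.val fun i => b ((monomialEquiv τ.n).symm (.inl i)) := by
      funext m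
      rcases m with i | z
      · rfl
      · induction z with
        | _ i j =>
          -- The added clauses are indexed by `i ≤ j`; the other order follows by symmetry of the
          -- product.
          have key : ∀ i j : Fin τ.n, i ≤ j →
              LinMonomial.val b ((monomialEquiv τ.n).symm (.inr s(i, j))) =
              LinMonomial.val b ((monomialEquiv τ.n).symm (.inl i)) *
                LinMonomial.val b ((monomialEquiv τ.n).symm (.inl j)) := by
            intro i j hij
            have h₁ := (axClause_holds _ _ _ i j).1
              (hb.1 _ (mem_axClauses.2 ⟨true, true, i, j, rfl, hij, rfl⟩))
            have h₂ := (axClause_holds _ _ _ i j).1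
              (hb.1 _ (mem_axClauses.2 ⟨true, false, i, j, rfl, hij, rfl⟩))
            have h₃ := (axClause_holds _ _ _ i j).1
              (hb.1 _ (mem_axClauses.2 ⟨false, true, i, j, rfl, hij, rfl⟩))
            simp only [LinMonomial.val, cond_true, cond_false] at h₁ h₂ h₃ ⊢
            generalize b ((monomialEquiv τ.n).symm (.inl i)) = x at h₁ h₂ h₃ ⊢
            generalize b ((monomialEquiv τ.n).symm (.inl j)) = y at h₁ h₂ h₃ ⊢
            generalize b ((monomialEquiv τ.n).symm (.inr s(i, j))) = z at h₁ h₂ h₃ ⊢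
            cases x <;> cases y <;> cases z <;> simp_all
          rcases le_total i j with h | h
          · exact key i j h
          · rw [Sym2.eq_swap]
            exact key j i h
    rw [hv] at hb
    exact hb.2
  · rintro ⟨a, ha⟩
    refine ⟨fun k : Fin (numMonomials τ.n) => decide (QuadMonomial.val a (monomialEquiv τ.n k) = 1), ?_⟩
    have hv : (fun m => LinMonomial.val
        (fun k => decide (QuadMonomial.val a (monomialEquiv τ.n k) = 1))
        ((monomialEquiv τ.n).symm m)) = QuadMonomial.val a := by
      funext m
      simp only [LinMonomial.val, Equiv.apply_symm_apply, decide_eq_true_eq]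
      rcases m with i | z
      · simp only [QuadMonomial.val, LinMonomial.val]
        by_cases hi : a i = true <;> simp [hi]
      · induction z with
        | _ i j =>
          simp only [QuadMonomial.val, LinMonomial.val, Sym2.lift_mk]
          by_cases hi : a i = true <;> by_cases hj : a j = true <;> simp [hi, hj]
    refine (toLinFormula_forall τ _).2 ?_
    rw [hv, List.forall_mem_append]
    refine ⟨fun C hC => ?_, ha⟩
    obtain ⟨ε₁, ε₂, i, j, hε, -, rfl⟩ := mem_axClauses.1 hC
    rw [axClause_holds]
    simp only [QuadMonomial.val, LinMonomial.val, Sym2.lift_mk]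
    cases ε₁ <;> cases ε₂ <;> cases a i <;> cases a j <;> simp_all

/-- Renaming monomials respects the rules, sends the axiom `xᵢ ∈ {0, 1}` to an axiom of R(lin), and
sends the axioms about products to the added clauses. -/
theorem RQuad.rLin {τ : QuadFormula} {s : List Letter} (h : RQuad τ s) :
    RLin (toLinFormula τ) s := by
  obtain ⟨π, hπ, rfl⟩ := h
  refine ⟨π.map (List.map toLinEq), ?_, encodeLines_toLinEq π⟩
  refine hπ.map (φ := toLinEq) (fun _ _ => rfl) (fun _ => rfl) (fun D hD => ?_)
    fun C hC => List.mem_map_of_mem (List.mem_append_right _ hC)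
  rcases quadAxioms_cases hD with ⟨i, rfl⟩ | ⟨C, hC, rfl⟩
  · refine .inl ⟨(monomialEquiv τ.n).symm (.inl i), ?_⟩
    have h (r : ℤ) : toLinEq ⟨quadVar i, r⟩ =
        ⟨Pi.single ((monomialEquiv τ.n).symm (.inl i)) 1, r⟩ := by
      ext k
      · simp [toLinEq, quadVar, Pi.single_apply, Equiv.eq_symm_apply]
      · rfl
    simp [boolEq, Set.image_insert_eq, h]
    rfl
  · exact .inr ⟨_, List.mem_map_of_mem (List.mem_append_left _ hC), (Clause.toSet_map _ C).symm⟩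

/-! ### From R(lin) to R(quad) -/

theorem encode_toLinFormula (τ : QuadFormula) :
    LinFormula.encode (toLinFormula τ) =
      List.replicate (τ.n + tri τ.n) Letter.plus ++ Letter.endClause ::
        (axiomString τ.n τ.n ++ encodeLines (quadMonomials τ.n) τ.clauses) := by
  have h : encodeLines (linMonomials (toLinFormula τ).n) (toLinFormula τ).clauses =
      axiomString τ.n τ.n ++ encodeLines (quadMonomials τ.n) τ.clauses := by
    rw [← encodeLines_axClauses]
    exact (encodeLines_toLinEq (axClauses τ.n ++ τ.clauses)).trans List.flatMap_append
  rw [← h, ← numMonomials_eq]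
  rfl

/-- Refutations are translated by the identity on strings, so a single program on pairs serves both
to check a proof and to translate a refutation. -/
theorem weaklyAutomatizable_rQuad_of_rLin
    (h : WeaklyAutomatizable LinFormula.encode LinFormula.Satisfiable RLin) :
    WeaklyAutomatizable QuadFormula.encode QuadFormula.Satisfiable RQuad := by
  have hpair : ProgTransforms (encodePair QuadFormula.encode)
      (fun x => encodePair LinFormula.encode (toLinFormula x.1, x.2)) :=
    Prog.progTransforms_ax (f := Sum.inl) (by simp) _ _ (encodePair_eq _)
      fun x => by simp [encodePair, encode_toLinFormula]
  refine h.of_reduction toLinFormula (fun x => x.2) toLinFormula_satisfiable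
    (fun τ π hπ => hπ.rLin) ?_ hpair hpair
  exact Prog.progTransforms_ax (f := id) (by simp) _ _ (encode_eq _)
    fun τ => by rw [encode_toLinFormula, List.map_id]; rfl

end ResEq

theorem theorem4 :
    ResEq.WeaklyAutomatizable ResEq.QuadFormula.encode ResEq.QuadFormula.Satisfiable ResEq.RQuad ↔
      ResEq.WeaklyAutomatizable ResEq.LinFormula.encode ResEq.LinFormula.Satisfiable ResEq.RLin :=
  ⟨ResEq.weaklyAutomatizable_rLin_of_rQuad, ResEq.weaklyAutomatizable_rQuad_of_rLin⟩
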